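/- Let $N\ge 1$ be an integer, $s\in(0,1)$, $p>1$, $N>ps$, $\gamma\in(0,1)$, put $p^*_s=\frac{pN}{N-ps}$, and let $\Omega\subset\mathbb R^N$ be a bounded open set (no regularity of $\partial\Omega$ is assumed). Let $M:[0,\infty)\to[0,\infty)$ be continuous and nondecreasing, and suppose that there are $a>0$ and $\vartheta$ with $$\int_0^t M(\tau)\,d\tau\ \ge\ a\,t^{\vartheta}\quad\text{for all } t\ge 0,\qquad\text{where } \vartheta\in(1,p^*_s/p)\ \text{ if } M(0)=0,\quad \vartheta=1\ \text{ if } M(0)>0 .$$ Let $W^{s,p}(\mathbb R^N)$ be the space of all $u\in L^p(\mathbb R^N)$ with $\|u\|^p:=\iint_{\mathbb R^{2N}}\frac{|u(x)-u(y)|^p}{|x-y|^{N+ps}}\,dx\,dy<\infty$, and let $X_0=\{u\in W^{s,p}(\mathbb R^N): u=0 \text{ a.e. in } \mathbb R^N\setminus\Omega\}$. Then there exists $\lambda_0>0$ such that for every $\lambda\in(0,\lambda_0]$ the problem $$M(\|u\|^p)\,(-\Delta)^s_p u=\frac{\lambda}{u^\gamma}+u^{p^*_s-1}\ \text{ in }\Omega,\qquad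 u>0\ \text{ in }\Omega,\qquad u=0\ \text{ in }\mathbb R^N\setminus\Omega$$ has a (weak) solution, that is, there is $u\in X_0$ with $u>0$ a.e. in $\Omega$ such that for every $\varphi\in X_0$ all the integrals below converge absolutely and $$M(\|u\|^p)\iint_{\mathbb R^{2N}}\frac{|u(x)-u(y)|^{p-2}(u(x)-u(y))(\varphi(x)-\varphi(y))}{|x-y|^{N+ps}}\,dx\,dy=\lambda\int_\Omega\frac{\varphi}{u^\gamma}\,dx+\int_\Omega u^{p^*_s-1}\varphi\,dx .$$ -/

import Mathlib

open MeasureTheory Set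

/-- The integrand `|u(x)-u(y)|^p / |x-y|^(N+ps)` of the Gagliardo energy, on `ℝ^N × ℝ^N`. -/
noncomputable def gagliardoIntegrand {N : ℕ} (s p : ℝ) (u : EuclideanSpace ℝ (Fin N) → ℝ)
    (z : EuclideanSpace ℝ (Fin N) × EuclideanSpace ℝ (Fin N)) : ℝ :=
  |u z.1 - u z.2| ^ p / ‖z.1 - z.2‖ ^ ((N : ℝ) + p * s)

/-- The `p`-th power `‖u‖^p = ∬ |u(x)-u(y)|^p / |x-y|^(N+ps) dx dy` of the Gagliardo norm. -/
noncomputable def gagliardoEnergy {N : ℕ} (s p : ℝ) (u : EuclideanSpace ℝ (Fin N) → ℝ) : ℝ :=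
  ∫ z, gagliardoIntegrand s p u z

/-- The integrand `|u(x)-u(y)|^(p-2) (u(x)-u(y)) (φ(x)-φ(y)) / |x-y|^(N+ps)` of the weak form of
the fractional `p`-Laplacian (at points with `u x = u y` its value is `0`, for every `p > 1`). -/
noncomputable def fracPLaplacianIntegrand {N : ℕ} (s p : ℝ)
    (u φ : EuclideanSpace ℝ (Fin N) → ℝ)
    (z : EuclideanSpace ℝ (Fin N) × EuclideanSpace ℝ (Fin N)) : ℝ :=
  |u z.1 - u z.2| ^ (p - 2) * (u z.1 - u z.2) * (φ z.1 - φ z.2) /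
    ‖z.1 - z.2‖ ^ ((N : ℝ) + p * s)

/-- The weak form `⟨(-Δ)^s_p u, φ⟩` of the fractional `p`-Laplacian, normalized so that for smooth
`u` it pairs `φ` with
`2 lim_{ε → 0} ∫_{|x-y| ≥ ε} |u(x)-u(y)|^(p-2) (u(x)-u(y)) / |x-y|^(N+ps) dy`. -/
noncomputable def fracPLaplacianForm {N : ℕ} (s p : ℝ)
    (u φ : EuclideanSpace ℝ (Fin N) → ℝ) : ℝ :=
  ∫ z, fracPLaplacianIntegrand s p u φ z

/-- `u` (a representative) belongs to the fractional Sobolev space `W^{s,p}(ℝ^N)`. -/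
def MemFracSobolev {N : ℕ} (s p : ℝ) (u : EuclideanSpace ℝ (Fin N) → ℝ) : Prop :=
  MemLp u (ENNReal.ofReal p) volume ∧ Integrable (gagliardoIntegrand s p u) volume

/-- `u` belongs to `X₀ = {u ∈ W^{s,p}(ℝ^N) : u = 0 a.e. in ℝ^N ∖ Ω}`. -/
def MemX0 {N : ℕ} (s p : ℝ) (Ω : Set (EuclideanSpace ℝ (Fin N)))
    (u : EuclideanSpace ℝ (Fin N) → ℝ) : Prop :=
  MemFracSobolev s p u ∧ ∀ᵐ x ∂volume, x ∉ Ω → u x = 0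

/-- The fractional critical Sobolev exponent `p*_s = pN/(N-ps)`. -/
noncomputable def fracCriticalExponent (N : ℕ) (s p : ℝ) : ℝ :=
  p * (N : ℝ) / ((N : ℝ) - p * s)

/-- The condition on the Kirchhoff coefficient; only the values of `M` on `[0, ∞)` matter. -/
def KirchhoffCondition (N : ℕ) (s p : ℝ) (M : ℝ → ℝ) : Prop :=
  (∀ t, 0 ≤ t → 0 ≤ M t) ∧ ContinuousOn M (Ici 0) ∧ MonotoneOn M (Ici 0) ∧
    ∃ a ϑ : ℝ, 0 < a ∧
      (M 0 = 0 → 1 < ϑ ∧ ϑ < fracCriticalExponent N s p / p) ∧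
      (0 < M 0 → ϑ = 1) ∧
      ∀ t, 0 ≤ t → a * t ^ ϑ ≤ ∫ τ in (0 : ℝ)..t, M τ

/-- `u` is a (weak) solution of
`M(‖u‖^p) (-Δ)^s_p u = lam u^(-γ) + u^(p*_s - 1)` in `Ω`, `u > 0` in `Ω`, `u = 0` outside `Ω`:
`u ∈ X₀`, `u > 0` a.e. in `Ω`, and for every test function `φ ∈ X₀` all the integrals of the weak
formulation converge absolutely and the weak formulation holds. -/
def IsKirchhoffSolution {N : ℕ} (s p γ : ℝ) (Ω : Set (EuclideanSpace ℝ (Fin N)))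
    (M : ℝ → ℝ) (lam : ℝ) (u : EuclideanSpace ℝ (Fin N) → ℝ) : Prop :=
  MemX0 s p Ω u ∧
  (∀ᵐ x ∂volume, x ∈ Ω → 0 < u x) ∧
  ∀ φ : EuclideanSpace ℝ (Fin N) → ℝ, MemX0 s p Ω φ →
    Integrable (fracPLaplacianIntegrand s p u φ) volume ∧
    IntegrableOn (fun x => φ x / u x ^ γ) Ω volume ∧
    IntegrableOn (fun x => u x ^ (fracCriticalExponent N s p - 1) * φ x) Ω volume ∧
    M (gagliardoEnergy s p u) * fracPLaplacianForm s p u φ =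
      lam * (∫ x in Ω, φ x / u x ^ γ) +
        ∫ x in Ω, u x ^ (fracCriticalExponent N s p - 1) * φ x

/-! The solution is a local minimizer of the energy J(v) = (1/p) 𝓜(‖v‖^p) − λ/(1−γ) ∫|v|^(1−γ) −
(1/q) ∫|v|^q, where q = p*_s and 𝓜 is the primitive of M vanishing at 0. Since ϑ < q/p, the lower
bound a t^ϑ for 𝓜 beats the Sobolev bound S t^(q/p) for the critical term when t ≤ R with R small,
and J is minimized over the ball ‖v‖^p ≤ R.

Existence (`exists_minimizer`). The critical embedding is not compact, but the loss is harmless in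
this ball. A minimizing sequence converges a.e. and in L^p along a subsequence
(`exists_subseq_ae_tendsto`), its energies tend to some e, and the Brezis–Lieb lemma, applied to the
functions and to their difference quotients, isolates a residual energy d = e − ‖u‖^p. As M is
nondecreasing, 𝓜 is superadditive, so 𝓜(e) ≥ 𝓜(‖u‖^p) + 𝓜(d), and the term 𝓜(d)/p pays for the
critical mass S d^(q/p)/q that may be lost in the limit.

Interiority (`exists_nonneg_interior_minimizer`). For small λ one has J ≥ 0 on the boundary of the
ball, while J < 0 at small multiples of a fixed positive function, because t^(1−γ) dominates t^p as
t → 0. Passing to |u| does not increase J, so u ≥ 0.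

Euler–Lagrange equation. J need not be differentiable, because of u^(−γ). For φ ≥ 0, one-sided
difference quotients, concavity of t^(1−γ) and Fatou's lemma give λ ∫ φ u^(−γ) ≤ (regular part of
the variation) (`IsInteriorMinimizer.variation_nonneg`). Finiteness of the left side for one φ
positive in Ω forces u > 0 a.e. there. Along the ray (1+t)u the functional is differentiable, so the
variation L satisfies L(u) = 0. For arbitrary φ, split φ = (φ−ku)⁺ − (φ−ku)⁻ + ku: then L(φ) ≤
L((φ−ku)⁺), whose upper bound tends to 0 as k → ∞ (`fullVariation_eq_zero`); applying this to −φ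
gives equality. -/

open Filter Topology

/-! ### Powers of L^q functions: Fatou, Brezis–Lieb, differentiation of the integral. -/

section LpPowers

variable {α : Type*} [MeasurableSpace α] {μ : Measure α} {q : ℝ} {f g : α → ℝ}

theorem memLp_iff_integrable_abs_rpow (hq : 0 < q) (hf : AEStronglyMeasurable f μ) :
    MemLp f (ENNReal.ofReal q) μ ↔ Integrable (fun x => |f x| ^ q) μ := by
  have h := integrable_norm_rpow_iff (p := ENNReal.ofReal q) hf (by simpa using hq) (by simp)
  rw [ENNReal.toReal_ofReal hq.le] at h
  exact h.symm

theorem MeasureTheory.MemLp.integrable_abs_rpow (hq : 0 < q) (hf : MemLp f (ENNReal.ofReal q) μ) :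
    Integrable (fun x => |f x| ^ q) μ :=
  (memLp_iff_integrable_abs_rpow hq hf.1).1 hf

theorem abs_add_rpow_le (hq : 0 ≤ q) (a b : ℝ) :
    |a + b| ^ q ≤ 2 ^ q * (|a| ^ q + |b| ^ q) := by
  have h1 : |a + b| ≤ 2 * max |a| |b| :=
    (abs_add_le a b).trans (by rw [two_mul]; exact add_le_add (le_max_left _ _) (le_max_right _ _))
  calc |a + b| ^ q ≤ (2 * max |a| |b|) ^ q := Real.rpow_le_rpow (abs_nonneg _) h1 hq
    _ = 2 ^ q * (max |a| |b|) ^ q :=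
        Real.mul_rpow (by norm_num) ((abs_nonneg a).trans (le_max_left _ _))
    _ ≤ 2 ^ q * (|a| ^ q + |b| ^ q) := by
        refine mul_le_mul_of_nonneg_left ?_ (by positivity)
        have ha : 0 ≤ |a| ^ q := by positivity
        have hb : 0 ≤ |b| ^ q := by positivity
        rcases max_cases |a| |b| with h | h <;> rw [h.1] <;> linarith

/-- If b is small relative to a, continuity of t ↦ t^q at t = 1, applied to |a+b|/|a|, gives the ε
term; otherwise |a| is bounded by a multiple of |b|. No convexity enters, so every q > 0 is allowed.
-/
theorem exists_abs_rpow_add_sub_le (hq : 0 < q) {ε : ℝ} (hε : 0 < ε) :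
    ∃ C : ℝ, 0 ≤ C ∧ ∀ a b : ℝ, |(|a + b| ^ q - |a| ^ q)| ≤ ε * |a| ^ q + C * |b| ^ q := by
  have hcont : ContinuousAt (fun t : ℝ => t ^ q) 1 := Real.continuousAt_rpow_const _ _ (by simp)
  obtain ⟨δ, hδ, hδ'⟩ := Metric.continuousAt_iff.1 hcont ε hε
  set η := δ / 2 with hη
  have hη0 : 0 < η := by positivity
  refine ⟨(1 + 1 / η) ^ q, by positivity, fun a b => ?_⟩
  rcases le_or_gt |b| (η * |a|) with h | h
  · rcases eq_or_ne a 0 with rfl | ha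
    · have hb : b = 0 := by simpa using h
      subst hb
      have : (0 : ℝ) ^ q = 0 := Real.zero_rpow hq.ne'
      simp [this]
    · have ha' : 0 < |a| := abs_pos.2 ha
      have key : dist (|a + b| / |a|) 1 < δ := by
        rw [Real.dist_eq]
        have e : |a + b| / |a| - 1 = (|a + b| - |a|) / |a| := by field_simp
        rw [e, abs_div, abs_abs, div_lt_iff₀ ha']
        have := abs_abs_sub_abs_le (a + b) a
        rw [add_sub_cancel_left] at this
        nlinarith
      have h2 := hδ' key
      rw [Real.dist_eq, Real.one_rpow, Real.div_rpow (abs_nonneg _) (abs_nonneg _)] at h2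
      have hpos : 0 < |a| ^ q := Real.rpow_pos_of_pos ha' _
      have e : |a + b| ^ q - |a| ^ q = (|a + b| ^ q / |a| ^ q - 1) * |a| ^ q := by field_simp
      rw [e, abs_mul, abs_of_pos hpos]
      have : 0 ≤ (1 + 1 / η) ^ q * |b| ^ q := by positivity
      nlinarith
  · have h1 : |a| ≤ 1 / η * |b| := by
      rw [div_mul_eq_mul_div, one_mul, le_div_iff₀ hη0]; linarith
    have hC : (1 + 1 / η) ^ q * |b| ^ q = ((1 + 1 / η) * |b|) ^ q :=
      (Real.mul_rpow (by positivity) (abs_nonneg _)).symm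
    have h2 : |a + b| ^ q ≤ (1 + 1 / η) ^ q * |b| ^ q := by
      rw [hC]
      refine Real.rpow_le_rpow (abs_nonneg _) ?_ hq.le
      have := abs_add_le a b
      nlinarith
    have h3 : |a| ^ q ≤ (1 + 1 / η) ^ q * |b| ^ q := by
      rw [hC]
      refine Real.rpow_le_rpow (abs_nonneg _) ?_ hq.le
      have := abs_nonneg b
      nlinarith
    have h4 : 0 ≤ |a + b| ^ q := by positivity
    have h5 : 0 ≤ |a| ^ q := by positivity
    have h6 : 0 ≤ ε * |a| ^ q := by positivity
    rw [abs_le]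
    constructor <;> linarith

theorem memLp_of_ae_tendsto_of_integral_le (hq : 0 < q) {F : ℕ → α → ℝ}
    (hF : ∀ n, MemLp (F n) (ENNReal.ofReal q) μ) {C : ℝ} (hC : ∀ n, ∫ x, |F n x| ^ q ∂μ ≤ C)
    (hae : ∀ᵐ x ∂μ, Tendsto (fun n => F n x) atTop (𝓝 (g x))) :
    MemLp g (ENNReal.ofReal q) μ := by
  have hgm : AEStronglyMeasurable g μ :=
    aestronglyMeasurable_of_tendsto_ae atTop (fun n => (hF n).1) hae
  have hcont : Continuous fun t : ℝ => ENNReal.ofReal (|t| ^ q) :=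
    ENNReal.continuous_ofReal.comp (continuous_abs.rpow_const fun _ => Or.inr hq.le)
  rw [memLp_iff_integrable_abs_rpow hq hgm]
  have hm : AEStronglyMeasurable (fun x => |g x| ^ q) μ :=
    ((continuous_abs.rpow_const fun _ => Or.inr hq.le).comp_aestronglyMeasurable hgm)
  refine ⟨hm, ?_⟩
  rw [hasFiniteIntegral_iff_ofReal (ae_of_all _ fun x => by positivity)]
  have h1 : ∫⁻ x, ENNReal.ofReal (|g x| ^ q) ∂μ
      = ∫⁻ x, liminf (fun n => ENNReal.ofReal (|F n x| ^ q)) atTop ∂μ := by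
    refine lintegral_congr_ae ?_
    filter_upwards [hae] with x hx
    exact (((hcont.tendsto _).comp hx).liminf_eq).symm
  rw [h1]
  refine (lintegral_liminf_le' fun n =>
    hcont.measurable.comp_aemeasurable (hF n).1.aemeasurable).trans_lt ?_
  refine lt_of_le_of_lt (b := ENNReal.ofReal C) ?_ ENNReal.ofReal_lt_top
  refine liminf_le_of_le (by isBoundedDefault) fun b hb => ?_
  obtain ⟨n, hn⟩ := hb.exists
  refine hn.trans ?_
  simp only [Function.comp_def]
  rw [← ofReal_integral_eq_lintegral_ofReal ((hF n).integrable_abs_rpow hq)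
    (ae_of_all _ fun x => by positivity)]
  exact ENNReal.ofReal_le_ofReal (hC n)

/-- The **Brezis–Lieb lemma**. -/
theorem tendsto_integral_abs_rpow_sub (hq : 0 < q) {F : ℕ → α → ℝ}
    (hF : ∀ n, MemLp (F n) (ENNReal.ofReal q) μ) {C : ℝ} (hC : ∀ n, ∫ x, |F n x| ^ q ∂μ ≤ C)
    (hae : ∀ᵐ x ∂μ, Tendsto (fun n => F n x) atTop (𝓝 (g x))) :
    Tendsto (fun n => ∫ x, |F n x| ^ q ∂μ - ∫ x, |F n x - g x| ^ q ∂μ) atTop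
      (𝓝 (∫ x, |g x| ^ q ∂μ)) := by
  have hg := memLp_of_ae_tendsto_of_integral_le hq hF hC hae
  have hgi := hg.integrable_abs_rpow hq
  have hFi := fun n => (hF n).integrable_abs_rpow hq
  have hdi : ∀ n, Integrable (fun x => |F n x - g x| ^ q) μ := fun n =>
    ((hF n).sub hg).integrable_abs_rpow hq
  set D := 2 ^ q * (C + ∫ x, |g x| ^ q ∂μ) with hD
  have hdD : ∀ n, ∫ x, |F n x - g x| ^ q ∂μ ≤ D := fun n => by
    calc ∫ x, |F n x - g x| ^ q ∂μ ≤ ∫ x, 2 ^ q * (|F n x| ^ q + |g x| ^ q) ∂μ := by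
          refine integral_mono (hdi n) (((hFi n).add hgi).const_mul _) fun x => ?_
          have := abs_add_rpow_le hq.le (F n x) (-g x)
          rwa [abs_neg, ← sub_eq_add_neg] at this
      _ = 2 ^ q * (∫ x, |F n x| ^ q ∂μ + ∫ x, |g x| ^ q ∂μ) := by
          rw [integral_const_mul, integral_add (hFi n) hgi]
      _ ≤ D := by
          have := hC n
          rw [hD]; gcongr
  have hD0 : 0 ≤ D := (integral_nonneg fun x => by positivity).trans (hdD 0)
  rw [Metric.tendsto_atTop]
  intro ε hε
  -- `D + 1` rather than `D`, since `D` may be 0.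
  have hε' : 0 < ε / (2 * (D + 1)) := by positivity
  obtain ⟨K, hK0, hK⟩ := exists_abs_rpow_add_sub_le hq hε'
  set ε' := ε / (2 * (D + 1))
  -- The excess of the Brezis–Lieb defect over ε'|F n − g|^q is dominated by a fixed multiple of
  -- |g|^q, so dominated convergence applies to it although it does not apply to the defect itself.
  set W : ℕ → α → ℝ := fun n x =>
    max (|(|F n x| ^ q - |F n x - g x| ^ q - |g x| ^ q)| - ε' * |F n x - g x| ^ q) 0 with hW
  have hWle : ∀ n x, |W n x| ≤ (K + 1) * |g x| ^ q := fun n x => by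
    have h0 : 0 ≤ |g x| ^ q := by positivity
    have h := hK (F n x - g x) (g x)
    rw [sub_add_cancel] at h
    rw [abs_of_nonneg (le_max_right _ _)]
    refine max_le ?_ (by positivity)
    have h2 := abs_sub (|F n x| ^ q - |F n x - g x| ^ q) (|g x| ^ q)
    rw [abs_of_nonneg h0] at h2
    linarith
  have hdm : ∀ n, AEStronglyMeasurable
      (fun x => |F n x| ^ q - |F n x - g x| ^ q - |g x| ^ q) μ :=
    fun n => (((hFi n).sub (hdi n)).sub hgi).1
  have hWm : ∀ n, AEStronglyMeasurable (W n) μ := fun n =>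
    (((hdm n).norm).sub ((hdi n).1.const_mul ε')).sup aestronglyMeasurable_const
  have hWi : ∀ n, Integrable (W n) μ := fun n =>
    Integrable.mono' (hgi.const_mul (K + 1)) (hWm n) (ae_of_all _ (hWle n))
  have hW0 : Tendsto (fun n => ∫ x, W n x ∂μ) atTop (𝓝 (∫ x, (0 : ℝ) ∂μ)) := by
    refine tendsto_integral_of_dominated_convergence _ hWm (hgi.const_mul (K + 1))
      (fun n => ae_of_all _ (hWle n)) ?_
    filter_upwards [hae] with x hx
    have hc : Continuous fun t : ℝ =>
        max (|(|t| ^ q - |t - g x| ^ q - |g x| ^ q)| - ε' * |t - g x| ^ q) 0 := by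
      have c1 : Continuous fun t : ℝ => |t| ^ q := continuous_abs.rpow_const fun _ => Or.inr hq.le
      have c2 : Continuous fun t : ℝ => |t - g x| ^ q :=
        c1.comp (continuous_id.sub continuous_const)
      fun_prop
    have := (hc.tendsto (g x)).comp hx
    simpa [hW, Function.comp_def, Real.zero_rpow hq.ne'] using this
  rw [integral_zero] at hW0
  obtain ⟨n₀, hn₀⟩ := (Metric.tendsto_atTop.1 hW0) (ε / 2) (by positivity)
  refine ⟨n₀, fun n hn => ?_⟩
  have h1 := hn₀ n hn
  rw [Real.dist_eq, sub_zero] at h1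
  rw [Real.dist_eq]
  calc |∫ x, |F n x| ^ q ∂μ - ∫ x, |F n x - g x| ^ q ∂μ - ∫ x, |g x| ^ q ∂μ|
      = |∫ x, (|F n x| ^ q - |F n x - g x| ^ q - |g x| ^ q) ∂μ| := by
        have e := integral_sub ((hFi n).sub (hdi n)) hgi
        simp only [Pi.sub_apply] at e
        rw [e, integral_sub (hFi n) (hdi n)]
    _ ≤ ∫ x, |(|F n x| ^ q - |F n x - g x| ^ q - |g x| ^ q)| ∂μ := abs_integral_le_integral_abs
    _ ≤ ∫ x, (W n x + ε' * |F n x - g x| ^ q) ∂μ := by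
        refine integral_mono (((hFi n).sub (hdi n)).sub hgi).abs
          ((hWi n).add ((hdi n).const_mul _)) fun x => ?_
        have := le_max_left (|(|F n x| ^ q - |F n x - g x| ^ q - |g x| ^ q)|
          - ε' * |F n x - g x| ^ q) 0
        simp only [hW]
        linarith
    _ = ∫ x, W n x ∂μ + ε' * ∫ x, |F n x - g x| ^ q ∂μ := by
        rw [integral_add (hWi n) ((hdi n).const_mul _), integral_const_mul]
    _ < ε / 2 + ε / 2 := by
        have h2 : ε' * ∫ x, |F n x - g x| ^ q ∂μ ≤ ε' * D :=
          mul_le_mul_of_nonneg_left (hdD n) hε'.le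
        have h3 : ε' * D ≤ ε / 2 := by
          simp only [ε']
          rw [div_mul_eq_mul_div, div_le_iff₀ (by positivity)]
          nlinarith
        have := (abs_lt.1 h1).2
        linarith
    _ = ε := by ring

/-- The product is at most the q-th power of the larger factor, which replaces Hölder's inequality.
-/
theorem integrable_abs_rpow_mul (hq : 1 < q) (hf : MemLp f (ENNReal.ofReal q) μ)
    (hg : MemLp g (ENNReal.ofReal q) μ) :
    Integrable (fun x => |f x| ^ (q - 1) * |g x|) μ := by
  have hq0 : 0 < q := by linarith
  have hm : AEStronglyMeasurable (fun x => |f x| ^ (q - 1) * |g x|) μ :=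
    ((continuous_abs.rpow_const fun _ => Or.inr (by linarith)).comp_aestronglyMeasurable hf.1).mul
      hg.1.norm
  refine Integrable.mono' ((hf.integrable_abs_rpow hq0).add (hg.integrable_abs_rpow hq0)) hm
    (ae_of_all _ fun x => ?_)
  have e : ∀ t : ℝ, 0 ≤ t → t ^ (q - 1) * t = t ^ q := fun t ht => by
    rcases ht.eq_or_lt with rfl | h
    · rw [mul_zero, Real.zero_rpow hq0.ne']
    · rw [← Real.rpow_add_one h.ne', sub_add_cancel]
  have h1 : 0 ≤ |f x| ^ q := by positivity
  have h2 : 0 ≤ |g x| ^ q := by positivity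
  rw [Real.norm_of_nonneg (by positivity), Pi.add_apply]
  rcases le_total |f x| |g x| with h | h
  · have : |f x| ^ (q - 1) * |g x| ≤ |g x| ^ (q - 1) * |g x| := by
      gcongr
    rw [e _ (abs_nonneg _)] at this
    linarith
  · have : |f x| ^ (q - 1) * |g x| ≤ |f x| ^ (q - 1) * |f x| := by gcongr
    rw [e _ (abs_nonneg _)] at this
    linarith

theorem abs_rpow_sub_two_mul_self (a : ℝ) (hq : 1 < q) :
    |(|a| ^ (q - 2) * a)| = |a| ^ (q - 1) := by
  rcases eq_or_ne a 0 with rfl | h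
  · rw [mul_zero, abs_zero, Real.zero_rpow (by linarith)]
  · rw [abs_mul, abs_of_nonneg (by positivity), ← Real.rpow_add_one (abs_ne_zero.2 h)]
    congr 1; ring

theorem aestronglyMeasurable_abs_rpow_sub_two_mul (hf : AEStronglyMeasurable f μ)
    (hg : AEStronglyMeasurable g μ) :
    AEStronglyMeasurable (fun x => |f x| ^ (q - 2) * f x * g x) μ := by
  have hm : Measurable fun t : ℝ => |t| ^ (q - 2) := by fun_prop
  exact ((hm.comp_aemeasurable hf.aemeasurable).aestronglyMeasurable.mul hf).mul hg

theorem integrable_abs_rpow_sub_two_mul (hq : 1 < q) (hf : MemLp f (ENNReal.ofReal q) μ)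
    (hg : MemLp g (ENNReal.ofReal q) μ) :
    Integrable (fun x => |f x| ^ (q - 2) * f x * g x) μ := by
  refine Integrable.mono' (integrable_abs_rpow_mul hq hf hg)
    (aestronglyMeasurable_abs_rpow_sub_two_mul hf.1 hg.1) (ae_of_all _ fun x => ?_)
  rw [Real.norm_eq_abs, abs_mul, abs_rpow_sub_two_mul_self _ hq]

/-- Differentiation under the integral: for |t| < 1 the t-derivative is dominated by
q(|f|+|g|)^(q−1)|g|. It is used both for the critical term and, with difference quotients, for the
Gagliardo energy. -/
theorem hasDerivAt_integral_abs_add_mul_rpow (hq : 1 < q) (hf : MemLp f (ENNReal.ofReal q) μ)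
    (hg : MemLp g (ENNReal.ofReal q) μ) :
    HasDerivAt (fun t : ℝ => ∫ x, |f x + t * g x| ^ q ∂μ)
      (q * ∫ x, |f x| ^ (q - 2) * f x * g x ∂μ) 0 := by
  have hq0 : 0 < q := by linarith
  have hL : ∀ t : ℝ, MemLp (fun x => f x + t * g x) (ENNReal.ofReal q) μ :=
    fun t => hf.add (hg.const_mul t)
  have h := hasDerivAt_integral_of_dominated_loc_of_deriv_le (μ := μ) (x₀ := (0 : ℝ))
    (F := fun t x => |f x + t * g x| ^ q)
    (F' := fun t x => q * (|f x + t * g x| ^ (q - 2) * (f x + t * g x) * g x))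
    (s := Metric.ball 0 1)
    (bound := fun x => q * ((|(|f x| + |g x|)|) ^ (q - 1) * |g x|))
    (Metric.ball_mem_nhds _ one_pos)
    (Eventually.of_forall fun t => ((hL t).integrable_abs_rpow hq0).1)
    (by simpa using hf.integrable_abs_rpow hq0)
    ((aestronglyMeasurable_abs_rpow_sub_two_mul (hL 0).1 hg.1).const_mul q)
    (ae_of_all _ fun x t ht => by
      rw [Metric.mem_ball, dist_zero_right, Real.norm_eq_abs] at ht
      rw [Real.norm_eq_abs, abs_mul, abs_mul, abs_rpow_sub_two_mul_self _ hq, abs_of_pos hq0]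
      have h1 : |f x + t * g x| ≤ |(|f x| + |g x|)| := by
        rw [abs_of_nonneg (by positivity : 0 ≤ |f x| + |g x|)]
        refine (abs_add_le _ _).trans ?_
        rw [abs_mul]
        have := abs_nonneg (g x)
        nlinarith
      gcongr)
    ((integrable_abs_rpow_mul hq (hf.abs.add hg.abs) hg).const_mul q)
    (ae_of_all _ fun x t _ => by
      have h1 : HasDerivAt (fun t : ℝ => f x + t * g x) (g x) t := by
        simpa using ((hasDerivAt_id t).mul_const (g x)).const_add (f x)
      have := (hasDerivAt_abs_rpow (f x + t * g x) hq).comp t h1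
      have e : q * |f x + t * g x| ^ (q - 2) * (f x + t * g x) * g x
          = q * (|f x + t * g x| ^ (q - 2) * (f x + t * g x) * g x) := by ring
      rw [e] at this
      exact this)
  have h2 := h.2
  simp only [zero_mul, add_zero, integral_const_mul] at h2
  exact h2

end LpPowers

/-! ### Lower semicontinuity of the L^q integral under a.e. convergence. -/

section LowerSemicontinuity

variable {α : Type*} [MeasurableSpace α] {μ : Measure α} {q : ℝ} {g : α → ℝ}

theorem integral_abs_rpow_le_of_ae_tendsto (hq : 0 < q) {F : ℕ → α → ℝ}
    (hF : ∀ n, MemLp (F n) (ENNReal.ofReal q) μ) {C : ℝ} (hC : ∀ n, ∫ x, |F n x| ^ q ∂μ ≤ C)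
    (hae : ∀ᵐ x ∂μ, Tendsto (fun n => F n x) atTop (𝓝 (g x))) :
    ∫ x, |g x| ^ q ∂μ ≤ C := by
  refine le_of_tendsto (tendsto_integral_abs_rpow_sub hq hF hC hae) (Eventually.of_forall fun n => ?_)
  have : 0 ≤ ∫ x, |F n x - g x| ^ q ∂μ := integral_nonneg fun x => by positivity
  linarith [hC n]

end LowerSemicontinuity

/-! ### Gagliardo energy as an L^p integral of difference quotients, and its slices. -/

section Gagliardo

variable {N : ℕ} {s p : ℝ} {Ω : Set (EuclideanSpace ℝ (Fin N))}
  {u v : EuclideanSpace ℝ (Fin N) → ℝ}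

/-- The weighted difference quotient whose `L^p` norm is the Gagliardo seminorm. -/
noncomputable def gagliardoQuotient (s p : ℝ) (u : EuclideanSpace ℝ (Fin N) → ℝ)
    (z : EuclideanSpace ℝ (Fin N) × EuclideanSpace ℝ (Fin N)) : ℝ :=
  (u z.1 - u z.2) / ‖z.1 - z.2‖ ^ (((N : ℝ) + p * s) / p)

theorem gagliardoIntegrand_eq (hp : 0 < p) (u : EuclideanSpace ℝ (Fin N) → ℝ)
    (z : EuclideanSpace ℝ (Fin N) × EuclideanSpace ℝ (Fin N)) :
    gagliardoIntegrand s p u z = |gagliardoQuotient s p u z| ^ p := by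
  have h0 : 0 ≤ ‖z.1 - z.2‖ ^ (((N : ℝ) + p * s) / p) := by positivity
  rw [gagliardoIntegrand, gagliardoQuotient, abs_div, abs_of_nonneg h0,
    Real.div_rpow (abs_nonneg _) h0, ← Real.rpow_mul (norm_nonneg _), div_mul_cancel₀ _ hp.ne']

/-- With weight k = |x−y|^((N+ps)/p) one has k^p = k^(p−2) k², so the weight distributes over the
three factors; on the diagonal both sides vanish. -/
theorem fracPLaplacianIntegrand_eq (hp : 0 < p) (u v : EuclideanSpace ℝ (Fin N) → ℝ)
    (z : EuclideanSpace ℝ (Fin N) × EuclideanSpace ℝ (Fin N)) :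
    fracPLaplacianIntegrand s p u v z =
      |gagliardoQuotient s p u z| ^ (p - 2) * gagliardoQuotient s p u z *
        gagliardoQuotient s p v z := by
  rcases eq_or_ne z.1 z.2 with h | h
  · simp [fracPLaplacianIntegrand, gagliardoQuotient, h]
  · have hpos : 0 < ‖z.1 - z.2‖ := norm_pos_iff.2 (sub_ne_zero.2 h)
    have hk : 0 < ‖z.1 - z.2‖ ^ (((N : ℝ) + p * s) / p) := by positivity
    have e : ‖z.1 - z.2‖ ^ ((N : ℝ) + p * s)
        = (‖z.1 - z.2‖ ^ (((N : ℝ) + p * s) / p)) ^ (p - 2)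
          * (‖z.1 - z.2‖ ^ (((N : ℝ) + p * s) / p)) ^ 2 := by
      rw [← Real.rpow_natCast, ← Real.rpow_add hk, ← Real.rpow_mul hpos.le]
      congr 1
      push_cast
      field_simp
      ring
    rw [fracPLaplacianIntegrand, gagliardoQuotient, gagliardoQuotient, abs_div,
      abs_of_pos hk, Real.div_rpow (abs_nonneg _) hk.le, e]
    field_simp

theorem gagliardoQuotient_add (u v : EuclideanSpace ℝ (Fin N) → ℝ) :
    gagliardoQuotient s p (fun x => u x + v x)
      = fun z => gagliardoQuotient s p u z + gagliardoQuotient s p v z := by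
  funext z; simp only [gagliardoQuotient]; ring

theorem gagliardoQuotient_sub (u v : EuclideanSpace ℝ (Fin N) → ℝ) :
    gagliardoQuotient s p (fun x => u x - v x)
      = fun z => gagliardoQuotient s p u z - gagliardoQuotient s p v z := by
  funext z; simp only [gagliardoQuotient]; ring

theorem gagliardoQuotient_const_mul (c : ℝ) (u : EuclideanSpace ℝ (Fin N) → ℝ) :
    gagliardoQuotient s p (fun x => c * u x) = fun z => c * gagliardoQuotient s p u z := by
  funext z; simp only [gagliardoQuotient]; ring

theorem aestronglyMeasurable_gagliardoQuotient (hu : AEStronglyMeasurable u volume) :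
    AEStronglyMeasurable (gagliardoQuotient s p u) volume := by
  have hm : Measurable fun z : EuclideanSpace ℝ (Fin N) × EuclideanSpace ℝ (Fin N) =>
      ‖z.1 - z.2‖ ^ (((N : ℝ) + p * s) / p) := by fun_prop
  exact ((hu.comp_fst.sub hu.comp_snd).aemeasurable.div hm.aemeasurable).aestronglyMeasurable

theorem memX0_iff (hp : 0 < p) : MemX0 s p Ω u ↔ MemLp u (ENNReal.ofReal p) volume ∧
    MemLp (gagliardoQuotient s p u) (ENNReal.ofReal p) volume ∧
      ∀ᵐ x ∂volume, x ∉ Ω → u x = 0 := by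
  have e : gagliardoIntegrand s p u = fun z => |gagliardoQuotient s p u z| ^ p :=
    funext (gagliardoIntegrand_eq hp u)
  rw [MemX0, MemFracSobolev, and_assoc, e]
  refine and_congr_right fun h => and_congr_left fun _ => ?_
  exact (memLp_iff_integrable_abs_rpow hp (aestronglyMeasurable_gagliardoQuotient h.1)).symm

theorem gagliardoEnergy_eq (hp : 0 < p) (u : EuclideanSpace ℝ (Fin N) → ℝ) :
    gagliardoEnergy s p u = ∫ z, |gagliardoQuotient s p u z| ^ p :=
  integral_congr_ae (ae_of_all _ (gagliardoIntegrand_eq hp u))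

theorem gagliardoIntegrand_nonneg (u : EuclideanSpace ℝ (Fin N) → ℝ)
    (z : EuclideanSpace ℝ (Fin N) × EuclideanSpace ℝ (Fin N)) :
    0 ≤ gagliardoIntegrand s p u z := by
  unfold gagliardoIntegrand; positivity

theorem gagliardoEnergy_nonneg (u : EuclideanSpace ℝ (Fin N) → ℝ) :
    0 ≤ gagliardoEnergy s p u :=
  integral_nonneg (gagliardoIntegrand_nonneg u)

theorem MemX0.add (hp : 0 < p) (hu : MemX0 s p Ω u) (hv : MemX0 s p Ω v) :
    MemX0 s p Ω (fun x => u x + v x) := by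
  rw [memX0_iff hp] at *
  refine ⟨hu.1.add hv.1, ?_, ?_⟩
  · rw [gagliardoQuotient_add]; exact hu.2.1.add hv.2.1
  · filter_upwards [hu.2.2, hv.2.2] with x h1 h2 hx
    rw [h1 hx, h2 hx, add_zero]

theorem MemX0.const_mul (hp : 0 < p) (hu : MemX0 s p Ω u) (c : ℝ) :
    MemX0 s p Ω (fun x => c * u x) := by
  rw [memX0_iff hp] at *
  refine ⟨hu.1.const_mul c, ?_, ?_⟩
  · rw [gagliardoQuotient_const_mul]; exact hu.2.1.const_mul c
  · filter_upwards [hu.2.2] with x h1 hx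
    rw [h1 hx, mul_zero]

theorem MemX0.sub (hp : 0 < p) (hu : MemX0 s p Ω u) (hv : MemX0 s p Ω v) :
    MemX0 s p Ω (fun x => u x - v x) := by
  have := hu.add hp (hv.const_mul hp (-1))
  simpa [sub_eq_add_neg] using this

theorem MemX0.aestronglyMeasurable (hu : MemX0 s p Ω u) : AEStronglyMeasurable u volume :=
  hu.1.1.1

theorem gagliardoEnergy_const_mul (c : ℝ) (u : EuclideanSpace ℝ (Fin N) → ℝ) :
    gagliardoEnergy s p (fun x => c * u x) = |c| ^ p * gagliardoEnergy s p u := by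
  rw [gagliardoEnergy, gagliardoEnergy, ← integral_const_mul]
  refine integral_congr_ae (ae_of_all _ fun z => ?_)
  simp only [gagliardoIntegrand]
  rw [← mul_sub, abs_mul, Real.mul_rpow (abs_nonneg _) (abs_nonneg _), mul_div_assoc]

/-- Contractions decrease the energy pointwise; this is what makes absolute values, positive parts
and truncations available in X₀. -/
theorem gagliardoIntegrand_comp_le (hp : 0 < p) {F : ℝ → ℝ} (hF : LipschitzWith 1 F)
    (u : EuclideanSpace ℝ (Fin N) → ℝ)
    (z : EuclideanSpace ℝ (Fin N) × EuclideanSpace ℝ (Fin N)) :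
    gagliardoIntegrand s p (fun x => F (u x)) z ≤ gagliardoIntegrand s p u z := by
  have h := hF.dist_le_mul (u z.1) (u z.2)
  simp only [Real.dist_eq, NNReal.coe_one, one_mul] at h
  unfold gagliardoIntegrand
  gcongr

theorem MemX0.comp_lipschitz (hp : 0 < p) (hu : MemX0 s p Ω u) {F : ℝ → ℝ}
    (hF : LipschitzWith 1 F) (h0 : F 0 = 0) : MemX0 s p Ω (fun x => F (u x)) := by
  have hm : AEStronglyMeasurable (fun x => F (u x)) volume :=
    hF.continuous.comp_aestronglyMeasurable hu.aestronglyMeasurable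
  refine ⟨⟨?_, ?_⟩, ?_⟩
  · refine hu.1.1.mono hm (ae_of_all _ fun x => ?_)
    have h := hF.dist_le_mul (u x) 0
    simpa [h0] using h
  · refine Integrable.mono' hu.1.2 ?_ (ae_of_all _ fun z => ?_)
    · have e : gagliardoIntegrand s p (fun x => F (u x))
          = fun z => |gagliardoQuotient s p (fun x => F (u x)) z| ^ p :=
        funext (gagliardoIntegrand_eq hp _)
      rw [e]
      exact (continuous_abs.rpow_const fun _ => Or.inr hp.le).comp_aestronglyMeasurable
        (aestronglyMeasurable_gagliardoQuotient hm)
    · rw [Real.norm_of_nonneg (gagliardoIntegrand_nonneg _ _)]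
      exact gagliardoIntegrand_comp_le hp hF u z
  · filter_upwards [hu.2] with x h1 hx
    rw [h1 hx, h0]

theorem gagliardoEnergy_comp_le (hp : 0 < p) (hu : MemX0 s p Ω u) {F : ℝ → ℝ}
    (hF : LipschitzWith 1 F) (h0 : F 0 = 0) :
    gagliardoEnergy s p (fun x => F (u x)) ≤ gagliardoEnergy s p u :=
  integral_mono (hu.comp_lipschitz hp hF h0).1.2 hu.1.2 (gagliardoIntegrand_comp_le hp hF u)

theorem lipschitzWith_abs : LipschitzWith 1 (fun t : ℝ => |t|) :=
  LipschitzWith.of_dist_le_mul fun a b => by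
    simpa [Real.dist_eq] using abs_abs_sub_abs_le a b

theorem lipschitzWith_max_zero : LipschitzWith 1 (fun t : ℝ => max t 0) :=
  LipschitzWith.of_dist_le_mul fun a b => by
    simpa [Real.dist_eq] using abs_max_sub_max_le_abs a b 0

theorem lipschitzWith_min_abs (c : ℝ) : LipschitzWith 1 (fun t : ℝ => min |t| c) :=
  LipschitzWith.of_dist_le_mul fun a b => by
    have := (abs_min_sub_min_le_max |a| c |b| c).trans
      (max_le (abs_abs_sub_abs_le a b) (by simp))
    simpa [Real.dist_eq] using this

theorem ae_prod_of_ae {P : EuclideanSpace ℝ (Fin N) → Prop} (h : ∀ᵐ x ∂volume, P x) :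
    ∀ᵐ z : EuclideanSpace ℝ (Fin N) × EuclideanSpace ℝ (Fin N) ∂volume, P z.1 ∧ P z.2 := by
  rw [Measure.volume_eq_prod]
  exact (Measure.quasiMeasurePreserving_fst.ae h).and (Measure.quasiMeasurePreserving_snd.ae h)

theorem ae_tendsto_gagliardoQuotient {F : ℕ → EuclideanSpace ℝ (Fin N) → ℝ}
    (h : ∀ᵐ x ∂volume, Tendsto (fun n => F n x) atTop (𝓝 (u x))) :
    ∀ᵐ z ∂volume, Tendsto (fun n => gagliardoQuotient s p (F n) z) atTop
      (𝓝 (gagliardoQuotient s p u z)) := by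
  filter_upwards [ae_prod_of_ae h] with z hz
  exact (hz.1.sub hz.2).div_const _

/-- The part of the Gagliardo energy seen from the point `x`. -/
noncomputable def gagliardoSlice (s p : ℝ) (u : EuclideanSpace ℝ (Fin N) → ℝ)
    (x : EuclideanSpace ℝ (Fin N)) : ENNReal :=
  ∫⁻ y, ENNReal.ofReal (gagliardoIntegrand s p u (x, y))

theorem aemeasurable_gagliardoSlice (hu : Integrable (gagliardoIntegrand s p u) volume) :
    AEMeasurable (gagliardoSlice s p u) volume :=
  AEMeasurable.lintegral_prod_right' (f := fun z => ENNReal.ofReal (gagliardoIntegrand s p u z))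
    hu.1.aemeasurable.ennreal_ofReal

theorem lintegral_gagliardoSlice (hu : Integrable (gagliardoIntegrand s p u) volume) :
    ∫⁻ x, gagliardoSlice s p u x = ENNReal.ofReal (gagliardoEnergy s p u) := by
  rw [gagliardoEnergy, ofReal_integral_eq_lintegral_ofReal hu
    (ae_of_all _ (gagliardoIntegrand_nonneg u)), Measure.volume_eq_prod]
  exact (lintegral_prod _ hu.1.aemeasurable.ennreal_ofReal).symm

theorem abs_sub_rpow_le_mul_gagliardoIntegrand (hp : 0 < p) (hs : 0 < s)
    {x y : EuclideanSpace ℝ (Fin N)} {d : ℝ} (hd : dist x y ≤ d) :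
    |u x - u y| ^ p ≤ d ^ ((N : ℝ) + p * s) * gagliardoIntegrand s p u (x, y) := by
  rcases eq_or_ne x y with rfl | h
  · simp [gagliardoIntegrand, Real.zero_rpow hp.ne']
  · have hpos : 0 < ‖x - y‖ := norm_pos_iff.2 (sub_ne_zero.2 h)
    have h1 : ‖x - y‖ ^ ((N : ℝ) + p * s) ≤ d ^ ((N : ℝ) + p * s) := by
      rw [← dist_eq_norm]; gcongr
    have h2 : 0 < ‖x - y‖ ^ ((N : ℝ) + p * s) := by positivity
    rw [gagliardoIntegrand, mul_div_assoc', le_div_iff₀ h2, mul_comm]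
    gcongr

theorem setLIntegral_abs_sub_rpow_le (hp : 0 < p) (hs : 0 < s)
    {x : EuclideanSpace ℝ (Fin N)} {d : ℝ} {B : Set (EuclideanSpace ℝ (Fin N))}
    (hB : MeasurableSet B) (hd : ∀ y ∈ B, dist x y ≤ d) (hd0 : 0 ≤ d) :
    ∫⁻ y in B, ENNReal.ofReal (|u x - u y| ^ p)
      ≤ ENNReal.ofReal (d ^ ((N : ℝ) + p * s)) * gagliardoSlice s p u x := by
  calc ∫⁻ y in B, ENNReal.ofReal (|u x - u y| ^ p)
      ≤ ∫⁻ y in B, ENNReal.ofReal (d ^ ((N : ℝ) + p * s)) *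
          ENNReal.ofReal (gagliardoIntegrand s p u (x, y)) := by
        refine setLIntegral_mono' hB fun y hy => ?_
        rw [← ENNReal.ofReal_mul (by positivity)]
        exact ENNReal.ofReal_le_ofReal (abs_sub_rpow_le_mul_gagliardoIntegrand hp hs (hd y hy))
    _ = ENNReal.ofReal (d ^ ((N : ℝ) + p * s)) *
          ∫⁻ y in B, ENNReal.ofReal (gagliardoIntegrand s p u (x, y)) :=
        lintegral_const_mul' _ _ ENNReal.ofReal_ne_top
    _ ≤ _ := by
        gcongr
        exact setLIntegral_le_lintegral _ _

end Gagliardo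

/-! ### The fractional Sobolev inequality, from a pointwise estimate. -/

section Sobolev

variable {N : ℕ} {s p q : ℝ} {Ω : Set (EuclideanSpace ℝ (Fin N))}
  {u v : EuclideanSpace ℝ (Fin N) → ℝ}

/-- Splitting at the height τ; an elementary substitute for Hölder's inequality, with τ left free
for later optimization. -/
theorem rpow_le_rpow_add_mul_rpow {a τ : ℝ} (ha : 0 ≤ a) (hτ : 0 < τ) (hp : 0 ≤ p) (hpq : p ≤ q) :
    a ^ p ≤ τ ^ p + τ ^ (p - q) * a ^ q := by
  rcases le_total a τ with h | h
  · have h1 : a ^ p ≤ τ ^ p := by gcongr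
    have h2 : 0 ≤ τ ^ (p - q) * a ^ q := by positivity
    linarith
  · have ha' : 0 < a := hτ.trans_le h
    have h1 : a ^ (p - q) ≤ τ ^ (p - q) := Real.rpow_le_rpow_of_nonpos hτ h (by linarith)
    have h2 : a ^ p = a ^ (p - q) * a ^ q := by rw [← Real.rpow_add ha']; congr 1; ring
    have h3 : 0 ≤ τ ^ p := by positivity
    rw [h2]
    have : a ^ (p - q) * a ^ q ≤ τ ^ (p - q) * a ^ q := by gcongr
    linarith

/-- The volume of the Euclidean unit ball. -/
noncomputable def unitBallVolume (N : ℕ) : ℝ :=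
  volume.real (Metric.ball (0 : EuclideanSpace ℝ (Fin N)) 1)

theorem unitBallVolume_pos (N : ℕ) : 0 < unitBallVolume N :=
  ENNReal.toReal_pos (Metric.measure_ball_pos _ _ one_pos).ne' measure_ball_lt_top.ne

theorem volume_ball_eq (x : EuclideanSpace ℝ (Fin N)) {r : ℝ} (hr : 0 < r) :
    volume (Metric.ball x r) = ENNReal.ofReal (unitBallVolume N * r ^ N) := by
  rw [Measure.addHaar_ball_of_pos _ _ hr, finrank_euclideanSpace_fin, mul_comm, unitBallVolume,
    ENNReal.ofReal_mul measureReal_nonneg, ofReal_measureReal measure_ball_lt_top.ne]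

/-- Averaging |u(x)|^p ≤ 2^p(|u(x)−u(y)|^p + |u(y)|^p) over y in a ball: the slice controls the
first part, and splitting at the height τ controls the second by the L^q mass. -/
theorem abs_rpow_mul_volume_ball_le (hp : 0 < p) (hs : 0 < s) (hpq : p ≤ q)
    (hu : AEStronglyMeasurable u volume) {U g r τ : ℝ} (hU0 : 0 ≤ U) (hg0 : 0 ≤ g)
    (hU : ∫⁻ x, ENNReal.ofReal (|u x| ^ q) ≤ ENNReal.ofReal U)
    {x : EuclideanSpace ℝ (Fin N)} (hg : gagliardoSlice s p u x ≤ ENNReal.ofReal g)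
    (hr : 0 < r) (hτ : 0 < τ) :
    |u x| ^ p * (unitBallVolume N * r ^ N) ≤ 2 ^ p * (r ^ ((N : ℝ) + p * s) * g +
      (τ ^ p * (unitBallVolume N * r ^ N) + τ ^ (p - q) * U)) := by
  have hω := unitBallVolume_pos N
  have hm : ∀ e : ℝ, AEMeasurable (fun y => ENNReal.ofReal (|u y| ^ e)) volume := fun e => by
    have h1 : Measurable fun t : ℝ => ENNReal.ofReal (|t| ^ e) := by fun_prop
    exact h1.comp_aemeasurable hu.aemeasurable
  have h1 : ENNReal.ofReal (|u x| ^ p) * volume (Metric.ball x r)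
      ≤ ENNReal.ofReal (2 ^ p) * ((∫⁻ y in Metric.ball x r, ENNReal.ofReal (|u x - u y| ^ p))
        + ∫⁻ y in Metric.ball x r, ENNReal.ofReal (|u y| ^ p)) := by
    rw [← setLIntegral_const, ← lintegral_add_right' _ (hm p).restrict,
      ← lintegral_const_mul' _ _ ENNReal.ofReal_ne_top]
    refine lintegral_mono fun y => ?_
    simp only
    rw [← ENNReal.ofReal_add (by positivity) (by positivity), ← ENNReal.ofReal_mul (by positivity)]
    refine ENNReal.ofReal_le_ofReal ?_
    have := abs_add_rpow_le hp.le (u x - u y) (u y)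
    rwa [sub_add_cancel] at this
  have h2 : ∫⁻ y in Metric.ball x r, ENNReal.ofReal (|u x - u y| ^ p)
      ≤ ENNReal.ofReal (r ^ ((N : ℝ) + p * s)) * ENNReal.ofReal g :=
    (setLIntegral_abs_sub_rpow_le hp hs measurableSet_ball
      (fun y hy => by rw [dist_comm]; exact (Metric.mem_ball.1 hy).le) hr.le).trans (by gcongr)
  have h3 : ∫⁻ y in Metric.ball x r, ENNReal.ofReal (|u y| ^ p)
      ≤ ENNReal.ofReal (τ ^ p) * volume (Metric.ball x r)
        + ENNReal.ofReal (τ ^ (p - q)) * ENNReal.ofReal U := by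
    calc ∫⁻ y in Metric.ball x r, ENNReal.ofReal (|u y| ^ p)
        ≤ ∫⁻ y in Metric.ball x r, (ENNReal.ofReal (τ ^ p)
            + ENNReal.ofReal (τ ^ (p - q)) * ENNReal.ofReal (|u y| ^ q)) := by
          refine lintegral_mono fun y => ?_
          simp only
          rw [← ENNReal.ofReal_mul (by positivity),
            ← ENNReal.ofReal_add (by positivity) (by positivity)]
          exact ENNReal.ofReal_le_ofReal (rpow_le_rpow_add_mul_rpow (abs_nonneg _) hτ hp.le hpq)
      _ = ENNReal.ofReal (τ ^ p) * volume (Metric.ball x r)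
            + ENNReal.ofReal (τ ^ (p - q)) *
              ∫⁻ y in Metric.ball x r, ENNReal.ofReal (|u y| ^ q) := by
          rw [lintegral_add_left measurable_const, setLIntegral_const,
            lintegral_const_mul' _ _ ENNReal.ofReal_ne_top]
      _ ≤ _ := by
          gcongr
          exact (setLIntegral_le_lintegral _ _).trans hU
  have h4 := h1.trans (mul_le_mul_right (add_le_add h2 h3) _)
  rw [volume_ball_eq x hr, ← ENNReal.ofReal_mul (by positivity),
    ← ENNReal.ofReal_mul (by positivity), ← ENNReal.ofReal_mul (by positivity),
    ← ENNReal.ofReal_mul (by positivity), ← ENNReal.ofReal_add (by positivity) (by positivity),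
    ← ENNReal.ofReal_add (by positivity) (by positivity),
    ← ENNReal.ofReal_mul (by positivity)] at h4
  exact (ENNReal.ofReal_le_ofReal_iff (by positivity)).1 h4

/-- The radius and the height in `abs_rpow_mul_volume_ball_le` are chosen to balance its terms. The
power U^(1−p/q) is such that integrating in x gives a closed inequality for U. -/
theorem abs_rpow_le_mul_gagliardoSlice (hN : 0 < N) (hp : 0 < p) (hs : 0 < s) (hps : p * s < N)
    (hq : q = p * N / (N - p * s))
    (hu : AEStronglyMeasurable u volume) {U g : ℝ} (hU0 : 0 < U) (hg0 : 0 < g)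
    (hU : ∫⁻ x, ENNReal.ofReal (|u x| ^ q) ≤ ENNReal.ofReal U)
    {x : EuclideanSpace ℝ (Fin N)} (hg : gagliardoSlice s p u x ≤ ENNReal.ofReal g) :
    |u x| ^ q ≤ (2 ^ p * (1 + 2 / unitBallVolume N)) ^ (q / p) * U ^ (1 - p / q) * g := by
  have hω := unitBallVolume_pos N
  have hN' : (0 : ℝ) < N := by exact_mod_cast hN
  have hsub : 0 < (N : ℝ) - p * s := by linarith
  have hq0 : 0 < q := by rw [hq]; positivity
  have hθ : p / q = (N - p * s) / N := by rw [hq]; field_simp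
  have hpq : p ≤ q := by
    have : p / q ≤ 1 := by
      rw [hθ, div_le_one hN']
      have : 0 < p * s := by positivity
      linarith
    rwa [div_le_one hq0] at this
  set θ := p / q
  have hps' : p * s = N * (1 - θ) := by rw [hθ]; field_simp; ring
  -- With r^N = ρ and τ^q = U/ρ, the three terms on the right become ρτ^p up to the volume of the
  -- unit ball, and τ^q = U^(1−θ) g.
  set ρ := U ^ θ / g with hρ
  have hρ0 : 0 < ρ := by positivity
  set r := ρ ^ ((N : ℝ)⁻¹)
  have hr : 0 < r := by positivity
  have hrN : r ^ (N : ℝ) = ρ := Real.rpow_inv_rpow hρ0.le hN'.ne'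
  have hrN' : r ^ N = ρ := by rw [← Real.rpow_natCast, hrN]
  set τ := (U / ρ) ^ q⁻¹
  have hτ : 0 < τ := by positivity
  have hτq : τ ^ q = U / ρ := Real.rpow_inv_rpow (by positivity) hq0.ne'
  have hUsplit : U ^ θ * U ^ (1 - θ) = U := by
    rw [← Real.rpow_add hU0, add_sub_cancel, Real.rpow_one]
  have hUθ : 0 < U ^ θ := by positivity
  have hUρ : U / ρ = U ^ (1 - θ) * g := by
    rw [hρ, div_div_eq_mul_div, div_eq_iff hUθ.ne']
    nth_rewrite 1 [← hUsplit]; ring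
  have hgρ : g * ρ = U ^ θ := by rw [hρ]; field_simp
  have hτp : τ ^ p = ρ ^ (1 - θ) * g := by
    have e : τ ^ p = (τ ^ q) ^ θ := by
      rw [← Real.rpow_mul hτ.le]; congr 1; simp only [θ]; field_simp
    have e2 : g = g ^ θ * g ^ (1 - θ) := by
      rw [← Real.rpow_add hg0, add_sub_cancel, Real.rpow_one]
    rw [e, hτq, hUρ, hρ, Real.div_rpow hUθ.le hg0.le, Real.mul_rpow (by positivity) hg0.le,
      ← Real.rpow_mul hU0.le, ← Real.rpow_mul hU0.le, mul_comm (1 - θ) θ]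
    have : 0 < g ^ (1 - θ) := by positivity
    nth_rewrite 3 [e2]
    field_simp
  have h := abs_rpow_mul_volume_ball_le hp hs hpq hu hU0.le hg0.le hU hg hr hτ
  have e1 : r ^ ((N : ℝ) + p * s) * g = ρ * τ ^ p := by
    rw [Real.rpow_add hr, hrN, hps', Real.rpow_mul hr.le, hrN, hτp]; ring
  have e2 : τ ^ (p - q) * U = ρ * τ ^ p := by
    rw [Real.rpow_sub hτ, hτq]; field_simp
  rw [e1, e2, hrN'] at h
  have h5 : |u x| ^ p ≤ (2 ^ p * (1 + 2 / unitBallVolume N)) * τ ^ p := by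
    have hc : 0 < unitBallVolume N * ρ := by positivity
    refine le_of_mul_le_mul_right (h.trans (le_of_eq ?_)) hc
    field_simp
    ring
  have h6 := Real.rpow_le_rpow (by positivity) h5 (by positivity : 0 ≤ q / p)
  rw [Real.mul_rpow (by positivity) (by positivity), ← Real.rpow_mul (abs_nonneg _),
    ← Real.rpow_mul hτ.le, mul_div_cancel₀ _ hp.ne', hτq, hUρ] at h6
  linarith

theorem le_mul_gagliardoEnergy_rpow (hN : 0 < N) (hp : 0 < p) (hs : 0 < s) (hps : p * s < N)
    (hq : q = p * N / (N - p * s))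
    (hu : MemX0 s p Ω u) (hu' : MemLp u (ENNReal.ofReal q) volume) :
    ∫ x, |u x| ^ q ≤ ((2 ^ p * (1 + 2 / unitBallVolume N)) ^ (q / p)) ^ (q / p) *
      gagliardoEnergy s p u ^ (q / p) := by
  have hω := unitBallVolume_pos N
  have hN' : (0 : ℝ) < N := by exact_mod_cast hN
  have hsub : 0 < (N : ℝ) - p * s := by linarith
  have hq0 : 0 < q := by rw [hq]; positivity
  set K := (2 ^ p * (1 + 2 / unitBallVolume N)) ^ (q / p) with hK
  have hK0 : 0 < K := by positivity
  have hE0 : 0 ≤ gagliardoEnergy s p u := gagliardoEnergy_nonneg u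
  have hi := hu'.integrable_abs_rpow hq0
  set U := ∫ x, |u x| ^ q with hUdef
  have hU0 : 0 ≤ U := integral_nonneg fun x => by positivity
  rcases hU0.eq_or_lt with h0 | hU
  · rw [← h0]; positivity
  have hUl : ∫⁻ x, ENNReal.ofReal (|u x| ^ q) = ENNReal.ofReal U :=
    (ofReal_integral_eq_lintegral_ofReal hi (ae_of_all _ fun x => by positivity)).symm
  have hpt : ∀ᵐ x ∂volume, ENNReal.ofReal (|u x| ^ q)
      ≤ ENNReal.ofReal (K * U ^ (1 - p / q)) * gagliardoSlice s p u x := by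
    have hfin : ∀ᵐ x ∂volume, gagliardoSlice s p u x < ⊤ :=
      ae_lt_top' (aemeasurable_gagliardoSlice hu.1.2)
        (by rw [lintegral_gagliardoSlice hu.1.2]; exact ENNReal.ofReal_ne_top)
    filter_upwards [hfin] with x hx
    have e := ENNReal.ofReal_toReal hx.ne
    rw [← e, ← ENNReal.ofReal_mul (by positivity)]
    refine ENNReal.ofReal_le_ofReal ?_
    have hpos : 0 < K * U ^ (1 - p / q) := by positivity
    rw [← div_le_iff₀' hpos]
    -- The pointwise estimate needs g > 0, whereas the slice may vanish, so the slice is approached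
    -- from above.
    refine le_of_forall_gt_imp_ge_of_dense fun g hg => ?_
    rw [div_le_iff₀' hpos]
    refine abs_rpow_le_mul_gagliardoSlice hN hp hs hps hq hu.aestronglyMeasurable hU
      (ENNReal.toReal_nonneg.trans_lt hg) hUl.le ?_
    rw [← e]
    exact ENNReal.ofReal_le_ofReal hg.le
  have hint := lintegral_mono_ae hpt
  rw [hUl, lintegral_const_mul' _ _ ENNReal.ofReal_ne_top, lintegral_gagliardoSlice hu.1.2,
    ← ENNReal.ofReal_mul (by positivity), ENNReal.ofReal_le_ofReal_iff (by positivity)] at hint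
  -- Dividing U ≤ K U^(1−p/q) E by U^(1−p/q) is legitimate because U is positive and already known
  -- to be finite.
  have h1 : U ^ (p / q) ≤ K * gagliardoEnergy s p u := by
    have hsp : U = U ^ (p / q) * U ^ (1 - p / q) := by
      rw [← Real.rpow_add hU, add_sub_cancel, Real.rpow_one]
    have hc : 0 < U ^ (1 - p / q) := by positivity
    refine le_of_mul_le_mul_right ?_ hc
    rw [← hsp]
    linarith
  have h2 := Real.rpow_le_rpow (by positivity) h1 (by positivity : 0 ≤ q / p)
  rw [← Real.rpow_mul hU.le, Real.mul_rpow hK0.le hE0] at h2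
  rwa [show p / q * (q / p) = 1 by field_simp, Real.rpow_one] at h2

/-- The **fractional Sobolev inequality** on `X₀`. -/
theorem exists_fractional_sobolev (hp : 0 < p) (hs : 0 < s) (hps : p * s < N)
    (hΩ : Bornology.IsBounded Ω) :
    ∃ S : ℝ, 0 < S ∧ ∀ u : EuclideanSpace ℝ (Fin N) → ℝ, MemX0 s p Ω u →
      MemLp u (ENNReal.ofReal (fracCriticalExponent N s p)) volume ∧
      ∫ x, |u x| ^ fracCriticalExponent N s p
        ≤ S * gagliardoEnergy s p u ^ (fracCriticalExponent N s p / p) := by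
  have hN' : (0 : ℝ) < N := lt_trans (by positivity) hps
  have hN : 0 < N := by exact_mod_cast hN'
  have hsub : 0 < (N : ℝ) - p * s := by linarith
  have hω := unitBallVolume_pos N
  set q := fracCriticalExponent N s p with hq
  have hq0 : 0 < q := by rw [hq, fracCriticalExponent]; positivity
  refine ⟨((2 ^ p * (1 + 2 / unitBallVolume N)) ^ (q / p)) ^ (q / p), by positivity,
    fun u hu => ?_⟩
  -- Truncations are bounded and vanish off a bounded set, hence lie in L^q a priori; their energies
  -- do not exceed that of u, so the bound is uniform in n and passes to the limit by Fatou's lemma.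
  have hux : ∀ n : ℕ, MemX0 s p Ω (fun x => min |u x| (n : ℝ)) := fun n =>
    hu.comp_lipschitz hp (lipschitzWith_min_abs n) (by simp)
  have hE : ∀ n : ℕ, gagliardoEnergy s p (fun x => min |u x| (n : ℝ)) ≤ gagliardoEnergy s p u :=
    fun n => gagliardoEnergy_comp_le hp hu (lipschitzWith_min_abs n) (by simp)
  have hL : ∀ n : ℕ, MemLp (fun x => min |u x| (n : ℝ)) (ENNReal.ofReal q) volume := fun n => by
    have hvol : volume (closure Ω) ≠ ⊤ := hΩ.closure.measure_lt_top.ne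
    refine MemLp.mono (g := (closure Ω).indicator fun _ => (n : ℝ))
      (memLp_indicator_const _ isClosed_closure.measurableSet _ (Or.inr hvol))
      (hux n).aestronglyMeasurable ?_
    filter_upwards [hu.2] with x hx
    by_cases h : x ∈ closure Ω
    · rw [indicator_of_mem h, Real.norm_of_nonneg (by positivity),
        Real.norm_of_nonneg (by positivity)]
      exact min_le_right _ _
    · simp [hx fun h' => h (subset_closure h')]
  have hb : ∀ n : ℕ, ∫ x, |(min |u x| (n : ℝ))| ^ q
      ≤ ((2 ^ p * (1 + 2 / unitBallVolume N)) ^ (q / p)) ^ (q / p) *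
        gagliardoEnergy s p u ^ (q / p) := fun n => by
    refine (le_mul_gagliardoEnergy_rpow hN hp hs hps hq (hux n) (hL n)).trans ?_
    have := gagliardoEnergy_nonneg (s := s) (p := p) (fun x => min |u x| (n : ℝ))
    have := hE n
    gcongr
  have hlim : ∀ᵐ x ∂volume, Tendsto (fun n : ℕ => min |u x| (n : ℝ)) atTop (𝓝 |u x|) :=
    ae_of_all _ fun x => by
      refine tendsto_const_nhds.congr' ?_
      filter_upwards [eventually_ge_atTop ⌈|u x|⌉₊] with n hn
      rw [min_eq_left (Nat.ceil_le.1 hn)]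
  have h1 := memLp_of_ae_tendsto_of_integral_le hq0 hL hb hlim
  have h2 := integral_abs_rpow_le_of_ae_tendsto hq0 hL hb hlim
  simp only [abs_abs] at h2
  exact ⟨(memLp_norm_iff hu.aestronglyMeasurable).1 h1, h2⟩

end Sobolev

/-! ### Completeness of L^q in terms of integrals of powers. -/

section LpComplete

variable {α : Type*} [MeasurableSpace α] {μ : Measure α} {q : ℝ} {f : α → ℝ}

theorem eLpNorm_ofReal_eq (hq : 0 < q) (hf : MemLp f (ENNReal.ofReal q) μ) :
    eLpNorm f (ENNReal.ofReal q) μ = ENNReal.ofReal ((∫ x, |f x| ^ q ∂μ) ^ q⁻¹) := by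
  rw [hf.eLpNorm_eq_integral_rpow_norm (by simpa using hq) ENNReal.ofReal_ne_top,
    ENNReal.toReal_ofReal hq.le]
  rfl

theorem integral_abs_rpow_eq (hq : 0 < q) (hf : MemLp f (ENNReal.ofReal q) μ) :
    ∫ x, |f x| ^ q ∂μ = (eLpNorm f (ENNReal.ofReal q) μ).toReal ^ q := by
  have h0 : 0 ≤ ∫ x, |f x| ^ q ∂μ := integral_nonneg fun x => by positivity
  rw [eLpNorm_ofReal_eq hq hf, ENNReal.toReal_ofReal (by positivity), Real.rpow_inv_rpow h0 hq.ne']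

theorem exists_ae_tendsto_of_cauchy_integral_abs_rpow (hq : 1 ≤ q) {F : ℕ → α → ℝ}
    (hF : ∀ n, MemLp (F n) (ENNReal.ofReal q) μ)
    (hC : ∀ ε : ℝ, 0 < ε → ∃ n₀, ∀ n ≥ n₀, ∀ m ≥ n₀, ∫ x, |F n x - F m x| ^ q ∂μ ≤ ε) :
    ∃ g : α → ℝ, ∃ ns : ℕ → ℕ, StrictMono ns ∧ MemLp g (ENNReal.ofReal q) μ ∧
      (∀ᵐ x ∂μ, Tendsto (fun n => F (ns n) x) atTop (𝓝 (g x))) ∧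
      Tendsto (fun n => ∫ x, |F n x - g x| ^ q ∂μ) atTop (𝓝 0) := by
  have hq0 : 0 < q := by linarith
  have : Fact (1 ≤ ENNReal.ofReal q) := ⟨by simpa using ENNReal.ofReal_le_ofReal hq⟩
  have hcs : CauchySeq fun n => (hF n).toLp (F n) := by
    rw [Metric.cauchySeq_iff]
    intro ε hε
    obtain ⟨n₀, hn₀⟩ := hC ((ε / 2) ^ q) (by positivity)
    refine ⟨n₀, fun n hn m hm => ?_⟩
    rw [dist_eq_norm, ← MemLp.toLp_sub, Lp.norm_toLp]
    have h0 : 0 ≤ ∫ x, |F n x - F m x| ^ q ∂μ := integral_nonneg fun x => by positivity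
    have h := eLpNorm_ofReal_eq hq0 ((hF n).sub (hF m))
    simp only [Pi.sub_apply] at h
    rw [h, ENNReal.toReal_ofReal (by positivity)]
    have h1 := Real.rpow_le_rpow h0 (hn₀ n hn m hm) (by positivity : 0 ≤ q⁻¹)
    rw [Real.rpow_rpow_inv (by positivity) hq0.ne'] at h1
    linarith
  obtain ⟨G, hG⟩ := cauchySeq_tendsto_of_complete hcs
  have hGm : MemLp (G : α → ℝ) (ENNReal.ofReal q) μ := Lp.memLp G
  have hG' : Tendsto (fun n => eLpNorm (F n - (G : α → ℝ)) (ENNReal.ofReal q) μ) atTop (𝓝 0) := by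
    rw [← Lp.tendsto_Lp_iff_tendsto_eLpNorm'' F hF G hGm]
    rwa [Lp.toLp_coeFn]
  obtain ⟨ns, hns, hae⟩ := (tendstoInMeasure_of_tendsto_eLpNorm (by simpa using hq0)
    (fun n => (hF n).1) hGm.1 hG').exists_seq_tendsto_ae
  refine ⟨G, ns, hns, hGm, hae, ?_⟩
  have h1 : Tendsto (fun n => (eLpNorm (F n - (G : α → ℝ)) (ENNReal.ofReal q) μ).toReal ^ q)
      atTop (𝓝 ((0 : ENNReal).toReal ^ q)) :=
    ((ENNReal.tendsto_toReal ENNReal.zero_ne_top).comp hG').rpow_const (Or.inr hq0.le)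
  rw [ENNReal.toReal_zero, Real.zero_rpow hq0.ne'] at h1
  refine h1.congr fun n => ?_
  exact (integral_abs_rpow_eq hq0 ((hF n).sub hGm)).symm

end LpComplete

/-! ### Compact embedding of X₀ into L^p through averages over small balls. -/

section Compactness

variable {N : ℕ} {s p q : ℝ} {Ω : Set (EuclideanSpace ℝ (Fin N))}
  {u v w : EuclideanSpace ℝ (Fin N) → ℝ}

/-- The mean value of `u` over the ball of centre `z` and radius `r`. -/
noncomputable def ballAverage (z : EuclideanSpace ℝ (Fin N)) (r : ℝ)
    (u : EuclideanSpace ℝ (Fin N) → ℝ) : ℝ :=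
  (unitBallVolume N * r ^ N)⁻¹ * ∫ y in Metric.ball z r, u y

theorem volume_real_ball_eq (x : EuclideanSpace ℝ (Fin N)) {r : ℝ} (hr : 0 < r) :
    volume.real (Metric.ball x r) = unitBallVolume N * r ^ N := by
  have := unitBallVolume_pos N
  rw [Measure.real, volume_ball_eq x hr, ENNReal.toReal_ofReal (by positivity)]

theorem integrableOn_ball_of_memLp (hp : 1 ≤ p) (hu : MemLp u (ENNReal.ofReal p) volume)
    (z : EuclideanSpace ℝ (Fin N)) (r : ℝ) : IntegrableOn u (Metric.ball z r) volume := by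
  have : IsFiniteMeasure (volume.restrict (Metric.ball z r)) := ⟨by
    simpa using measure_ball_lt_top⟩
  exact hu.restrict _ |>.integrable (by simpa using ENNReal.ofReal_le_ofReal hp)

/-- Jensen's inequality moves the p-th power inside the average; points of the ball are within 2r of
x, so the slice at x bounds the result. -/
theorem abs_sub_ballAverage_rpow_le (hp : 1 < p) (hs : 0 < s)
    (hw : MemLp w (ENNReal.ofReal p) volume) {x z : EuclideanSpace ℝ (Fin N)} {r : ℝ} (hr : 0 < r)
    (hxz : dist x z < r) :
    ENNReal.ofReal (|w x - ballAverage z r w| ^ p)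
      ≤ ENNReal.ofReal ((unitBallVolume N * r ^ N)⁻¹ * (2 * r) ^ ((N : ℝ) + p * s)) *
        gagliardoSlice s p w x := by
  have hp0 : 0 < p := by linarith
  have hω := unitBallVolume_pos N
  set B := Metric.ball z r with hB
  have hBr : volume.real B = unitBallVolume N * r ^ N := volume_real_ball_eq z hr
  have hBpos : 0 < volume.real B := by rw [hBr]; positivity
  have : IsFiniteMeasure (volume.restrict B) := ⟨by simpa using measure_ball_lt_top⟩
  have hwB : Integrable w (volume.restrict B) := integrableOn_ball_of_memLp hp.le hw z r
  have hd : MemLp (fun y => w x - w y) (ENNReal.ofReal p) (volume.restrict B) :=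
    (memLp_const (w x)).sub (hw.restrict _)
  have hdi : Integrable (fun y => |w x - w y|) (volume.restrict B) :=
    ((integrable_const (w x)).sub hwB).abs
  have hdp := hd.integrable_abs_rpow hp0
  have havg : ∀ f : EuclideanSpace ℝ (Fin N) → ℝ,
      ⨍ y in B, f y = (unitBallVolume N * r ^ N)⁻¹ * ∫ y in B, f y := fun f => by
    rw [setAverage_eq, hBr, smul_eq_mul]
  have h1 : |w x - ballAverage z r w| ≤ ⨍ y in B, |w x - w y| := by
    have e : w x - ballAverage z r w
        = (unitBallVolume N * r ^ N)⁻¹ * ∫ y in B, (w x - w y) := by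
      rw [integral_sub (integrable_const _) hwB, setIntegral_const, hBr, smul_eq_mul, ballAverage,
        mul_sub, inv_mul_cancel_left₀ (by positivity)]
    rw [e, havg, abs_mul, abs_of_pos (by positivity)]
    gcongr
    exact abs_integral_le_integral_abs
  have h2 : (⨍ y in B, |w x - w y|) ^ p ≤ ⨍ y in B, |w x - w y| ^ p :=
    (convexOn_rpow hp.le).map_set_average_le
      (Real.continuous_rpow_const hp0.le).continuousOn isClosed_Ici
      (Metric.measure_ball_pos _ _ hr).ne' measure_ball_lt_top.ne
      (ae_of_all _ fun y => abs_nonneg (w x - w y)) hdi hdp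
  have h3 := (Real.rpow_le_rpow (abs_nonneg _) h1 hp0.le).trans h2
  rw [havg] at h3
  calc ENNReal.ofReal (|w x - ballAverage z r w| ^ p)
      ≤ ENNReal.ofReal ((unitBallVolume N * r ^ N)⁻¹ * ∫ y in B, |w x - w y| ^ p) :=
        ENNReal.ofReal_le_ofReal h3
    _ = ENNReal.ofReal ((unitBallVolume N * r ^ N)⁻¹) *
          ∫⁻ y in B, ENNReal.ofReal (|w x - w y| ^ p) := by
        rw [ENNReal.ofReal_mul (by positivity), ofReal_integral_eq_lintegral_ofReal hdp
          (ae_of_all _ fun y => by positivity)]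
    _ ≤ ENNReal.ofReal ((unitBallVolume N * r ^ N)⁻¹) *
          (ENNReal.ofReal ((2 * r) ^ ((N : ℝ) + p * s)) * gagliardoSlice s p w x) := by
        gcongr
        refine setLIntegral_abs_sub_rpow_le hp0 hs measurableSet_ball (fun y hy => ?_)
          (by positivity)
        have := dist_triangle_right x y z
        have := Metric.mem_ball.1 hy
        linarith
    _ = _ := by rw [← mul_assoc, ← ENNReal.ofReal_mul (by positivity)]

/-- Replacing w by nearby averages costs r^(ps) times the energy. Hence, for functions of bounded
energy, small averages over a cover of Ω by small balls force a small L^p norm. The centre may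
depend on x. -/
theorem integral_abs_rpow_le_of_ballAverage_le (hp : 1 < p) (hs : 0 < s) (hΩm : MeasurableSet Ω)
    (hΩ : Bornology.IsBounded Ω) (hw : MemX0 s p Ω w) {r η : ℝ} (hr : 0 < r) (hη : 0 ≤ η)
    (hcov : ∀ x ∈ Ω, ∃ z, dist x z < r ∧ |ballAverage z r w| ≤ η) :
    ∫ x, |w x| ^ p ≤ 2 ^ p * (2 ^ ((N : ℝ) + p * s) / unitBallVolume N * r ^ (p * s) *
      gagliardoEnergy s p w + η ^ p * volume.real Ω) := by
  have hp0 : 0 < p := by linarith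
  have hω := unitBallVolume_pos N
  have hE := gagliardoEnergy_nonneg (s := s) (p := p) w
  set K := 2 ^ ((N : ℝ) + p * s) / unitBallVolume N * r ^ (p * s) with hK
  have hK0 : 0 < K := by positivity
  have hKe : (unitBallVolume N * r ^ N)⁻¹ * (2 * r) ^ ((N : ℝ) + p * s) = K := by
    rw [Real.mul_rpow (by norm_num) hr.le, Real.rpow_add hr, Real.rpow_natCast, hK]
    field_simp
  have hpt : ∀ x ∈ Ω, ENNReal.ofReal (|w x| ^ p)
      ≤ ENNReal.ofReal (2 ^ p) * (ENNReal.ofReal K * gagliardoSlice s p w x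
        + ENNReal.ofReal (η ^ p)) := fun x hx => by
    obtain ⟨z, hz, hc⟩ := hcov x hx
    have h1 := abs_sub_ballAverage_rpow_le hp hs hw.1.1 hr hz
    rw [hKe] at h1
    have h2 := abs_add_rpow_le hp0.le (w x - ballAverage z r w) (ballAverage z r w)
    rw [sub_add_cancel] at h2
    have h3 : |ballAverage z r w| ^ p ≤ η ^ p := by gcongr
    calc ENNReal.ofReal (|w x| ^ p)
        ≤ ENNReal.ofReal (2 ^ p * (|w x - ballAverage z r w| ^ p + η ^ p)) :=
          ENNReal.ofReal_le_ofReal (h2.trans (by gcongr))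
      _ = ENNReal.ofReal (2 ^ p) * (ENNReal.ofReal (|w x - ballAverage z r w| ^ p)
            + ENNReal.ofReal (η ^ p)) := by
          rw [ENNReal.ofReal_mul (by positivity),
            ENNReal.ofReal_add (by positivity) (by positivity)]
      _ ≤ _ := by gcongr
  have hvol : volume Ω ≠ ⊤ := hΩ.measure_lt_top.ne
  have hi := hw.1.1.integrable_abs_rpow hp0
  have e1 : ∫⁻ x, ENNReal.ofReal (|w x| ^ p) = ∫⁻ x in Ω, ENNReal.ofReal (|w x| ^ p) := by
    rw [← lintegral_indicator hΩm]
    refine lintegral_congr_ae ?_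
    filter_upwards [hw.2] with x hx
    by_cases h : x ∈ Ω
    · rw [indicator_of_mem h]
    · rw [indicator_of_notMem h, hx h, abs_zero, Real.zero_rpow hp0.ne', ENNReal.ofReal_zero]
  have hfinal : ENNReal.ofReal (∫ x, |w x| ^ p) ≤ ENNReal.ofReal (2 ^ p *
      (K * gagliardoEnergy s p w + η ^ p * volume.real Ω)) := by
    rw [ofReal_integral_eq_lintegral_ofReal hi (ae_of_all _ fun x => by positivity), e1]
    calc ∫⁻ x in Ω, ENNReal.ofReal (|w x| ^ p)
        ≤ ∫⁻ x in Ω, ENNReal.ofReal (2 ^ p) * (ENNReal.ofReal K * gagliardoSlice s p w x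
            + ENNReal.ofReal (η ^ p)) := setLIntegral_mono' hΩm hpt
      _ = ENNReal.ofReal (2 ^ p) * (ENNReal.ofReal K * (∫⁻ x in Ω, gagliardoSlice s p w x)
            + ENNReal.ofReal (η ^ p) * volume Ω) := by
          rw [lintegral_const_mul' _ _ ENNReal.ofReal_ne_top,
            lintegral_add_right _ measurable_const, setLIntegral_const,
            lintegral_const_mul' _ _ ENNReal.ofReal_ne_top]
      _ ≤ ENNReal.ofReal (2 ^ p) * (ENNReal.ofReal K * ENNReal.ofReal (gagliardoEnergy s p w)
            + ENNReal.ofReal (η ^ p) * ENNReal.ofReal (volume.real Ω)) := by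
          rw [← lintegral_gagliardoSlice hw.1.2, ofReal_measureReal hvol]
          gcongr
          exact Measure.restrict_le_self
      _ = _ := by
          rw [← ENNReal.ofReal_mul (by positivity), ← ENNReal.ofReal_mul (by positivity),
            ← ENNReal.ofReal_add (by positivity) (by positivity),
            ← ENNReal.ofReal_mul (by positivity)]
  exact (ENNReal.ofReal_le_ofReal_iff (by positivity)).1 hfinal

theorem abs_ballAverage_le (hq : 1 ≤ q) (hu : MemLp u (ENNReal.ofReal q) volume)
    (z : EuclideanSpace ℝ (Fin N)) {r : ℝ} (hr : 0 < r) :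
    |ballAverage z r u| ≤ 1 + (unitBallVolume N * r ^ N)⁻¹ * ∫ y, |u y| ^ q := by
  have hω := unitBallVolume_pos N
  have hq0 : 0 < q := by linarith
  have hi := hu.integrable_abs_rpow hq0
  have hc : 0 < unitBallVolume N * r ^ N := by positivity
  have : IsFiniteMeasure (volume.restrict (Metric.ball z r)) := ⟨by
    simpa using measure_ball_lt_top⟩
  have h1 : |∫ y in Metric.ball z r, u y|
      ≤ unitBallVolume N * r ^ N + ∫ y, |u y| ^ q := by
    calc |∫ y in Metric.ball z r, u y| ≤ ∫ y in Metric.ball z r, |u y| :=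
          abs_integral_le_integral_abs
      _ ≤ ∫ y in Metric.ball z r, (1 + |u y| ^ q) := by
          refine integral_mono (integrableOn_ball_of_memLp hq hu z r).abs
            ((integrable_const _).add hi.restrict) fun y => ?_
          simpa using rpow_le_rpow_add_mul_rpow (abs_nonneg (u y)) one_pos zero_le_one hq
      _ = unitBallVolume N * r ^ N + ∫ y in Metric.ball z r, |u y| ^ q := by
          rw [integral_add (integrable_const _) hi.restrict, setIntegral_const,
            volume_real_ball_eq z hr, smul_eq_mul, mul_one]
      _ ≤ _ := by
          gcongr
          · exact ae_of_all _ fun y => by positivity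
          · exact Measure.restrict_le_self
  rw [ballAverage, abs_mul, abs_of_pos (by positivity)]
  calc (unitBallVolume N * r ^ N)⁻¹ * |∫ y in Metric.ball z r, u y|
      ≤ (unitBallVolume N * r ^ N)⁻¹ * (unitBallVolume N * r ^ N + ∫ y, |u y| ^ q) := by gcongr
    _ = _ := by rw [mul_add, inv_mul_cancel₀ hc.ne']

theorem gagliardoEnergy_sub_le (hp : 0 < p) (hu : MemX0 s p Ω u) (hv : MemX0 s p Ω v) :
    gagliardoEnergy s p (fun x => u x - v x)
      ≤ 2 ^ p * (gagliardoEnergy s p u + gagliardoEnergy s p v) := by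
  have hu' := ((memX0_iff hp).1 hu).2.1.integrable_abs_rpow hp
  have hv' := ((memX0_iff hp).1 hv).2.1.integrable_abs_rpow hp
  have hs' := ((memX0_iff hp).1 (hu.sub hp hv)).2.1.integrable_abs_rpow hp
  rw [gagliardoEnergy_eq hp, gagliardoEnergy_eq hp, gagliardoEnergy_eq hp,
    ← integral_add hu' hv', ← integral_const_mul]
  refine integral_mono hs' ((hu'.add hv').const_mul _) fun z => ?_
  rw [gagliardoQuotient_sub]
  have := abs_add_rpow_le hp.le (gagliardoQuotient s p u z) (-gagliardoQuotient s p v z)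
  rwa [abs_neg, ← sub_eq_add_neg] at this

/-- Compactness of the embedding of `X₀` into `L^p`. -/
theorem exists_subseq_ae_tendsto (hp : 1 < p) (hs : 0 < s) (hps : p * s < N)
    (hΩo : IsOpen Ω) (hΩ : Bornology.IsBounded Ω) {F : ℕ → EuclideanSpace ℝ (Fin N) → ℝ}
    (hF : ∀ n, MemX0 s p Ω (F n)) {R : ℝ} (hR : ∀ n, gagliardoEnergy s p (F n) ≤ R) :
    ∃ ns : ℕ → ℕ, StrictMono ns ∧ ∃ u, MemX0 s p Ω u ∧
      (∀ᵐ x ∂volume, Tendsto (fun n => F (ns n) x) atTop (𝓝 (u x))) ∧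
      Tendsto (fun n => ∫ x, |F (ns n) x - u x| ^ p) atTop (𝓝 0) := by
  have hp0 : 0 < p := by linarith
  have hω := unitBallVolume_pos N
  have hN' : (0 : ℝ) < N := lt_trans (by positivity) hps
  have hR0 : 0 ≤ R := (gagliardoEnergy_nonneg _).trans (hR 0)
  have hsub : 0 < (N : ℝ) - p * s := by linarith
  obtain ⟨S, hS0, hS⟩ := exists_fractional_sobolev hp0 hs hps hΩ
  set q := fracCriticalExponent N s p with hq
  have hq1 : 1 ≤ q := by
    rw [hq, fracCriticalExponent, le_div_iff₀ hsub]
    have : 0 < p * s := by positivity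
    nlinarith
  set D := TopologicalSpace.denseSeq (EuclideanSpace ℝ (Fin N))
  have hrad : ∀ k : ℕ, (0 : ℝ) < 1 / ((k : ℝ) + 1) := fun k => by positivity
  -- Countably many averages, with centres in a dense sequence and radii 1/(k+1), each bounded in n
  -- by the Sobolev inequality. Compactness of the countable product of intervals then replaces a
  -- diagonal extraction.
  set A : ℕ → (ℕ × ℕ → ℝ) := fun n ik => ballAverage (D ik.1) (1 / ((ik.2 : ℝ) + 1)) (F n)
  set Cb : ℕ × ℕ → ℝ := fun ik =>
    1 + (unitBallVolume N * (1 / ((ik.2 : ℝ) + 1)) ^ N)⁻¹ * (S * R ^ (q / p))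
  have hA : ∀ n, A n ∈ Set.pi univ fun ik => Icc (-Cb ik) (Cb ik) := fun n ik _ => by
    rw [mem_Icc, ← abs_le]
    refine (abs_ballAverage_le hq1 (hS _ (hF n)).1 _ (hrad _)).trans ?_
    have h1 := (hS _ (hF n)).2
    have h2 := gagliardoEnergy_nonneg (s := s) (p := p) (F n)
    have h3 : gagliardoEnergy s p (F n) ^ (q / p) ≤ R ^ (q / p) := by
      have := hR n; gcongr
    have h4 : ∫ y, |F n y| ^ q ≤ S * R ^ (q / p) := h1.trans (by gcongr)
    simp only [Cb]
    gcongr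
  obtain ⟨a, -, φ, hφ, hlim⟩ :=
    (isCompact_univ_pi fun ik : ℕ × ℕ => isCompact_Icc (a := -Cb ik) (b := Cb ik)).tendsto_subseq hA
  have hcoord : ∀ ik, CauchySeq fun n => A (φ n) ik := fun ik =>
    ((tendsto_pi_nhds.1 hlim) ik).cauchySeq
  have hsubX : ∀ n m, MemX0 s p Ω (fun x => F n x - F m x) := fun n m => (hF n).sub hp0 (hF m)
  have hsubE : ∀ n m, gagliardoEnergy s p (fun x => F n x - F m x) ≤ 2 ^ p * (R + R) :=
    fun n m => (gagliardoEnergy_sub_le hp0 (hF n) (hF m)).trans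
      (mul_le_mul_of_nonneg_left (add_le_add (hR n) (hR m)) (by positivity))
  have hcauchy : ∀ ε : ℝ, 0 < ε → ∃ n₀, ∀ n ≥ n₀, ∀ m ≥ n₀,
      ∫ x, |F (φ n) x - F (φ m) x| ^ p ≤ ε := by
    intro ε hε
    have hk : ∃ k : ℕ, 2 ^ p * (2 ^ ((N : ℝ) + p * s) / unitBallVolume N *
        (1 / ((k : ℝ) + 1)) ^ (p * s) * (2 ^ p * (R + R))) < ε / 2 := by
      have h1 : Tendsto (fun k : ℕ => 2 ^ p * (2 ^ ((N : ℝ) + p * s) / unitBallVolume N *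
          (1 / ((k : ℝ) + 1)) ^ (p * s) * (2 ^ p * (R + R)))) atTop
          (𝓝 (2 ^ p * (2 ^ ((N : ℝ) + p * s) / unitBallVolume N *
            (0 : ℝ) ^ (p * s) * (2 ^ p * (R + R))))) :=
        (((tendsto_one_div_add_atTop_nhds_zero_nat.rpow_const
          (Or.inr (by positivity))).const_mul _).mul_const _).const_mul _
      rw [Real.zero_rpow (by positivity)] at h1
      simp only [mul_zero, zero_mul] at h1
      exact (h1.eventually_lt_const (by positivity : (0 : ℝ) < ε / 2)).exists
    obtain ⟨k, hk⟩ := hk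
    obtain ⟨η, hη0, hη⟩ : ∃ η : ℝ, 0 < η ∧ 2 ^ p * (η ^ p * volume.real Ω) < ε / 2 := by
      have h1 : Tendsto (fun η : ℝ => 2 ^ p * (η ^ p * volume.real Ω)) (𝓝[>] 0)
          (𝓝 (2 ^ p * ((0 : ℝ) ^ p * volume.real Ω))) :=
        (((tendsto_id.mono_left nhdsWithin_le_nhds).rpow_const
          (Or.inr hp0.le)).mul_const _).const_mul _
      rw [Real.zero_rpow hp0.ne', zero_mul, mul_zero] at h1
      obtain ⟨η, h2, h3⟩ := ((h1.eventually_lt_const (by positivity : (0 : ℝ) < ε / 2)).and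
        self_mem_nhdsWithin).exists
      exact ⟨η, h3, h2⟩
    set r : ℝ := 1 / ((k : ℝ) + 1)
    have hr : 0 < r := hrad k
    -- At a fixed radius finitely many centres cover the closure of Ω, so coordinatewise convergence
    -- of the averages is uniform over the centres needed.
    obtain ⟨t, ht⟩ := hΩ.isCompact_closure.elim_finite_subcover
      (fun i => Metric.ball (D i) r) (fun i => Metric.isOpen_ball) (fun x _ => by
        obtain ⟨i, hi⟩ := (TopologicalSpace.denseRange_denseSeq
          (EuclideanSpace ℝ (Fin N))).exists_dist_lt x hr
        exact mem_iUnion.2 ⟨i, hi⟩)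
    have hev : ∀ i ∈ t, ∀ᶠ n₀ : ℕ in atTop, ∀ n ≥ n₀, ∀ m ≥ n₀,
        |A (φ n) (i, k) - A (φ m) (i, k)| ≤ η := fun i _ => by
      obtain ⟨n₀, hn₀⟩ := Metric.cauchySeq_iff.1 (hcoord (i, k)) η hη0
      filter_upwards [eventually_ge_atTop n₀] with n₁ hn₁ n hn m hm
      exact (hn₀ n (hn₁.trans hn) m (hn₁.trans hm)).le
    obtain ⟨n₀, hn₀⟩ := ((Filter.eventually_all_finset t).2 hev).exists
    refine ⟨n₀, fun n hn m hm => ?_⟩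
    refine (integral_abs_rpow_le_of_ballAverage_le hp hs hΩo.measurableSet hΩ
      (hsubX (φ n) (φ m)) hr hη0.le fun x hx => ?_).trans ?_
    · obtain ⟨i, hit, hi⟩ := mem_iUnion₂.1 (ht (subset_closure hx))
      refine ⟨D i, Metric.mem_ball.1 hi, ?_⟩
      have e : ballAverage (D i) r (fun x => F (φ n) x - F (φ m) x)
          = A (φ n) (i, k) - A (φ m) (i, k) := by
        simp only [A, ballAverage]
        rw [integral_sub (integrableOn_ball_of_memLp hp.le (hF _).1.1 _ _)
          (integrableOn_ball_of_memLp hp.le (hF _).1.1 _ _), mul_sub]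
      rw [e]
      exact hn₀ i hit n hn m hm
    · have h1 : 2 ^ ((N : ℝ) + p * s) / unitBallVolume N * r ^ (p * s) *
          gagliardoEnergy s p (fun x => F (φ n) x - F (φ m) x)
          ≤ 2 ^ ((N : ℝ) + p * s) / unitBallVolume N * r ^ (p * s) * (2 ^ p * (R + R)) := by
        gcongr
        exact hsubE _ _
      have h2 : (0 : ℝ) < 2 ^ p := by positivity
      rw [mul_add]
      have := mul_le_mul_of_nonneg_left h1 h2.le
      linarith
  obtain ⟨u, ns, hns, hu, hae, hint⟩ := exists_ae_tendsto_of_cauchy_integral_abs_rpow hp.le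
    (fun n => (hF (φ n)).1.1) hcauchy
  have hX := fun n => (memX0_iff hp0).1 (hF (φ (ns n)))
  have hE : ∀ n, ∫ z, |gagliardoQuotient s p (F (φ (ns n))) z| ^ p ≤ R := fun n => by
    rw [← gagliardoEnergy_eq hp0]; exact hR _
  have hint' := hint.comp hns.tendsto_atTop
  refine ⟨φ ∘ ns, hφ.comp hns, u, (memX0_iff hp0).2 ⟨hu, ?_, ?_⟩, hae, hint'⟩
  · exact memLp_of_ae_tendsto_of_integral_le hp0 (fun n => (hX n).2.1) hE
      (ae_tendsto_gagliardoQuotient hae)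
  · have h1 : ∀ᵐ x ∂volume, ∀ n, x ∉ Ω → F (φ (ns n)) x = 0 := ae_all_iff.2 fun n => (hX n).2.2
    filter_upwards [hae, h1] with x hx h2 hxΩ
    refine tendsto_nhds_unique hx ?_
    simp only [h2 _ hxΩ]
    exact tendsto_const_nhds

end Compactness

/-! ### An element of X₀ positive in Ω: the distance to the complement. -/

section DistanceFunction

variable {N : ℕ} {s p : ℝ} {Ω : Set (EuclideanSpace ℝ (Fin N))}

/-- In polar coordinates the radial integrand is at most t^(p−1−ps) near 0, integrable because s <
1, and at most a multiple of t^(−1−ps) at infinity, integrable because s > 0. -/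
theorem integrable_min_rpow_div_norm_rpow (hN : 0 < N) (hp : 0 < p) (hs0 : 0 < s) (hs1 : s < 1)
    {D : ℝ} (hD : 0 ≤ D) :
    Integrable (fun z : EuclideanSpace ℝ (Fin N) =>
      (min ‖z‖ D) ^ p / ‖z‖ ^ ((N : ℝ) + p * s)) volume := by
  have : Nontrivial (EuclideanSpace ℝ (Fin N)) := by
    have : Nonempty (Fin N) := ⟨⟨0, hN⟩⟩
    infer_instance
  have h := integrable_fun_norm_addHaar (volume : Measure (EuclideanSpace ℝ (Fin N)))
    (f := fun t : ℝ => (min t D) ^ p / t ^ ((N : ℝ) + p * s))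
  rw [h, finrank_euclideanSpace_fin]
  have hm : Measurable fun t : ℝ => t ^ (N - 1) • ((min t D) ^ p / t ^ ((N : ℝ) + p * s)) := by
    fun_prop
  have e : ∀ t : ℝ, 0 < t → t ^ (N - 1) / t ^ ((N : ℝ) + p * s) = t ^ (-1 - p * s) := by
    intro t ht
    rw [← Real.rpow_natCast, Nat.cast_sub hN, ← Real.rpow_sub ht]
    congr 1; push_cast; ring
  rw [← Ioc_union_Ioi_eq_Ioi (zero_le_one' ℝ)]
  refine IntegrableOn.union ?_ ?_
  · have h1 : IntegrableOn (fun t : ℝ => t ^ (p - 1 - p * s)) (Ioc 0 1) volume :=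
      (intervalIntegrable_iff_integrableOn_Ioc_of_le zero_le_one).1
        (intervalIntegral.intervalIntegrable_rpow' (by nlinarith))
    refine Integrable.mono' h1 hm.aestronglyMeasurable ?_
    filter_upwards [ae_restrict_mem measurableSet_Ioc] with t ht
    have ht0 : 0 < t := ht.1
    have hmin : 0 ≤ min t D := le_min ht0.le hD
    rw [Real.norm_of_nonneg (by positivity), smul_eq_mul]
    calc t ^ (N - 1) * ((min t D) ^ p / t ^ ((N : ℝ) + p * s))
        = (min t D) ^ p * (t ^ (N - 1) / t ^ ((N : ℝ) + p * s)) := by ring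
      _ ≤ t ^ p * t ^ (-1 - p * s) := by
          rw [e t ht0]
          gcongr
          exact min_le_left _ _
      _ = t ^ (p - 1 - p * s) := by rw [← Real.rpow_add ht0]; congr 1; ring
  · have h1 : IntegrableOn (fun t : ℝ => D ^ p * t ^ (-1 - p * s)) (Ioi 1) volume :=
      (integrableOn_Ioi_rpow_of_lt (by nlinarith) one_pos).const_mul _
    refine Integrable.mono' h1 hm.aestronglyMeasurable ?_
    filter_upwards [ae_restrict_mem measurableSet_Ioi] with t ht
    have ht0 : 0 < t := lt_trans one_pos ht
    have hmin : 0 ≤ min t D := le_min ht0.le hD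
    rw [Real.norm_of_nonneg (by positivity), smul_eq_mul]
    calc t ^ (N - 1) * ((min t D) ^ p / t ^ ((N : ℝ) + p * s))
        = (min t D) ^ p * (t ^ (N - 1) / t ^ ((N : ℝ) + p * s)) := by ring
      _ ≤ D ^ p * t ^ (-1 - p * s) := by
          rw [e t ht0]
          gcongr
          exact min_le_right _ _

theorem memX0_of_lipschitz (hN : 0 < N) (hp : 0 < p) (hs0 : 0 < s) (hs1 : s < 1)
    (hΩo : IsOpen Ω) (hΩ : Bornology.IsBounded Ω) {ψ : EuclideanSpace ℝ (Fin N) → ℝ}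
    (hψ : LipschitzWith 1 ψ) (h0 : ∀ x ∉ Ω, ψ x = 0) {D : ℝ} (hD : ∀ x, |ψ x| ≤ D) :
    MemX0 s p Ω ψ := by
  have hD0 : 0 ≤ D := (abs_nonneg _).trans (hD 0)
  have hm : AEStronglyMeasurable ψ volume := hψ.continuous.aestronglyMeasurable
  have hvol : volume Ω ≠ ⊤ := hΩ.measure_lt_top.ne
  set h : EuclideanSpace ℝ (Fin N) → ℝ :=
    fun z => (min ‖z‖ (2 * D)) ^ p / ‖z‖ ^ ((N : ℝ) + p * s) with hh
  have hhi : Integrable h volume := integrable_min_rpow_div_norm_rpow hN hp hs0 hs1 (by positivity)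
  have hh0 : ∀ z, 0 ≤ h z := fun z => by
    have : 0 ≤ min ‖z‖ (2 * D) := le_min (norm_nonneg _) (by positivity)
    simp only [h]; positivity
  set I : EuclideanSpace ℝ (Fin N) → ℝ := Ω.indicator fun _ => (1 : ℝ) with hI
  have hIi : Integrable I volume := (integrable_indicator_iff hΩo.measurableSet).2
    (integrableOn_const hvol)
  -- The integrand of ψ is at most h(x−y) and vanishes unless x or y lies in Ω. It is therefore
  -- dominated by the convolution integrand of 1_Ω with h plus its reflection.
  have hc : Integrable (fun z : EuclideanSpace ℝ (Fin N) × EuclideanSpace ℝ (Fin N) =>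
      I z.2 * h (z.1 - z.2)) volume :=
    hIi.convolution_integrand (ContinuousLinearMap.mul ℝ ℝ) hhi
  have hc' : Integrable (fun z : EuclideanSpace ℝ (Fin N) × EuclideanSpace ℝ (Fin N) =>
      I z.1 * h (z.2 - z.1)) volume := hc.swap
  have hI0 : ∀ x, 0 ≤ I x := fun x => indicator_nonneg (fun _ _ => zero_le_one) x
  refine ⟨⟨?_, ?_⟩, ae_of_all _ h0⟩
  · refine MemLp.mono (g := Ω.indicator fun _ => D)
      (memLp_indicator_const _ hΩo.measurableSet _ (Or.inr hvol)) hm (ae_of_all _ fun x => ?_)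
    by_cases hx : x ∈ Ω
    · rw [indicator_of_mem hx, Real.norm_of_nonneg hD0]; exact hD x
    · simp [h0 x hx]
  · have hgm : AEStronglyMeasurable (gagliardoIntegrand s p ψ) volume := by
      rw [show gagliardoIntegrand s p ψ = fun z => |gagliardoQuotient s p ψ z| ^ p from
        funext (gagliardoIntegrand_eq hp ψ)]
      exact (continuous_abs.rpow_const fun _ => Or.inr hp.le).comp_aestronglyMeasurable
        (aestronglyMeasurable_gagliardoQuotient hm)
    refine Integrable.mono' (hc.add hc') hgm (ae_of_all _ fun z => ?_)
    rw [Real.norm_of_nonneg (gagliardoIntegrand_nonneg _ _), Pi.add_apply]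
    have hsymm : h (z.2 - z.1) = h (z.1 - z.2) := by simp only [h, norm_sub_rev]
    rw [hsymm]
    have hle : gagliardoIntegrand s p ψ z ≤ h (z.1 - z.2) := by
      have h1 : |ψ z.1 - ψ z.2| ≤ ‖z.1 - z.2‖ := by
        simpa [Real.dist_eq, dist_eq_norm] using hψ.dist_le_mul z.1 z.2
      have h2 : |ψ z.1 - ψ z.2| ≤ 2 * D := by
        have := abs_sub (ψ z.1) (ψ z.2)
        linarith [hD z.1, hD z.2]
      simp only [h, gagliardoIntegrand]
      gcongr
      exact le_min h1 h2
    have hz := hh0 (z.1 - z.2)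
    by_cases h1 : z.1 ∈ Ω
    · have e : I z.1 = 1 := indicator_of_mem h1 _
      have := mul_nonneg (hI0 z.2) hz
      rw [e]; linarith
    · by_cases h2 : z.2 ∈ Ω
      · have e : I z.2 = 1 := indicator_of_mem h2 _
        have := mul_nonneg (hI0 z.1) hz
        rw [e]; linarith
      · have e : gagliardoIntegrand s p ψ z = 0 := by
          simp [gagliardoIntegrand, h0 _ h1, h0 _ h2, Real.zero_rpow hp.ne']
        rw [e]
        exact add_nonneg (mul_nonneg (hI0 _) hz) (mul_nonneg (hI0 _) hz)

theorem exists_memX0_pos (hN : 0 < N) (hp : 0 < p) (hs0 : 0 < s) (hs1 : s < 1)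
    (hΩo : IsOpen Ω) (hΩ : Bornology.IsBounded Ω) :
    ∃ ψ : EuclideanSpace ℝ (Fin N) → ℝ, MemX0 s p Ω ψ ∧ (∀ x, 0 ≤ ψ x) ∧ ∀ x ∈ Ω, 0 < ψ x := by
  have : Nontrivial (EuclideanSpace ℝ (Fin N)) := by
    have : Nonempty (Fin N) := ⟨⟨0, hN⟩⟩
    infer_instance
  have hne : (Ωᶜ).Nonempty := by
    rw [nonempty_compl]
    rintro rfl
    exact NormedSpace.unbounded_univ ℝ _ hΩ
  obtain ⟨y, hy⟩ := hne
  obtain ⟨D, hD⟩ := hΩ.subset_closedBall y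
  have hz : ∀ x ∉ Ω, Metric.infDist x Ωᶜ = 0 := fun x hx =>
    Metric.infDist_zero_of_mem hx
  refine ⟨fun x => Metric.infDist x Ωᶜ, ?_, fun x => Metric.infDist_nonneg, fun x hx => ?_⟩
  · refine memX0_of_lipschitz hN hp hs0 hs1 hΩo hΩ (Metric.lipschitz_infDist_pt _) hz
      (D := max D 0) fun x => ?_
    rw [abs_of_nonneg Metric.infDist_nonneg]
    by_cases hx : x ∈ Ω
    · exact (Metric.infDist_le_dist_of_mem hy).trans ((Metric.mem_closedBall.1 (hD hx)).trans
        (le_max_left _ _))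
    · rw [hz x hx]; exact le_max_right _ _
  · rw [← (hΩo.isClosed_compl).notMem_iff_infDist_pos ⟨y, hy⟩]
    exact fun h => h hx

end DistanceFunction

/-! ### The primitive of the Kirchhoff coefficient. -/

section Primitive

variable {M : ℝ → ℝ}

/-- Translating the interval [0, y] to [x, x+y] can only increase the integral of a nondecreasing
function. This superadditivity separates the energy of the limit from the residual energy in
`exists_minimizer`. -/
theorem integral_add_integral_le_of_monotone (hMc : Continuous M) (hMm : Monotone M) {x y : ℝ}
    (hx : 0 ≤ x) (hy : 0 ≤ y) :
    (∫ τ in (0 : ℝ)..x, M τ) + ∫ τ in (0 : ℝ)..y, M τ ≤ ∫ τ in (0 : ℝ)..(x + y), M τ := by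
  have hi : ∀ a b, IntervalIntegrable M volume a b := fun a b => hMc.intervalIntegrable a b
  rw [← intervalIntegral.integral_add_adjacent_intervals (hi 0 x) (hi x (x + y))]
  have e : ∫ τ in x..(x + y), M τ = ∫ τ in (0 : ℝ)..y, M (τ + x) := by
    rw [intervalIntegral.integral_comp_add_right, zero_add, add_comm]
  rw [e]
  have : ∫ τ in (0 : ℝ)..y, M τ ≤ ∫ τ in (0 : ℝ)..y, M (τ + x) :=
    intervalIntegral.integral_mono_on hy (hi _ _)
      ((hMc.comp (continuous_id.add continuous_const)).intervalIntegrable _ _)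
      fun t _ => hMm (by linarith)
  linarith

theorem primitive_le_primitive (hMc : Continuous M) (hM0 : ∀ t, 0 ≤ M t) {x y : ℝ} (hxy : x ≤ y) :
    ∫ τ in (0 : ℝ)..x, M τ ≤ ∫ τ in (0 : ℝ)..y, M τ := by
  have hi : ∀ a b, IntervalIntegrable M volume a b := fun a b => hMc.intervalIntegrable a b
  rw [← intervalIntegral.integral_add_adjacent_intervals (hi 0 x) (hi x y)]
  have := intervalIntegral.integral_nonneg (μ := volume) hxy fun t _ => hM0 t
  linarith

theorem hasDerivAt_primitive (hMc : Continuous M) (x : ℝ) :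
    HasDerivAt (fun t => ∫ τ in (0 : ℝ)..t, M τ) (M x) x :=
  intervalIntegral.integral_hasDerivAt_right (hMc.intervalIntegrable _ _)
    hMc.stronglyMeasurable.stronglyMeasurableAtFilter hMc.continuousAt

end Primitive

/-! ### The sublinear term and its continuity along L^p-convergent sequences. -/

section Sublinear

variable {N : ℕ} {s p q r γ : ℝ} {Ω : Set (EuclideanSpace ℝ (Fin N))}
  {u v : EuclideanSpace ℝ (Fin N) → ℝ}

theorem integral_abs_rpow_le_of_support (hr : 0 < r) (hrq : r ≤ q) (hΩm : MeasurableSet Ω)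
    (hΩ : Bornology.IsBounded Ω) (hv : MemLp v (ENNReal.ofReal q) volume)
    (h0 : ∀ᵐ x ∂volume, x ∉ Ω → v x = 0) :
    Integrable (fun x => |v x| ^ r) volume ∧ ∀ τ : ℝ, 0 < τ →
      ∫ x, |v x| ^ r ≤ τ ^ r * volume.real Ω + τ ^ (r - q) * ∫ x, |v x| ^ q := by
  have hq : 0 < q := by linarith
  have hvi := hv.integrable_abs_rpow hq
  have hvol : volume Ω ≠ ⊤ := hΩ.measure_lt_top.ne
  have hind : ∀ c : ℝ, Integrable (Ω.indicator fun _ => c) volume := fun c =>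
    (integrable_indicator_iff hΩm).2 (integrableOn_const hvol)
  have hb : ∀ τ : ℝ, 0 < τ → ∀ᵐ x ∂volume,
      |v x| ^ r ≤ Ω.indicator (fun _ => τ ^ r) x + τ ^ (r - q) * |v x| ^ q := fun τ hτ => by
    filter_upwards [h0] with x hx
    by_cases h : x ∈ Ω
    · rw [indicator_of_mem h]
      exact rpow_le_rpow_add_mul_rpow (abs_nonneg _) hτ hr.le hrq
    · rw [indicator_of_notMem h, hx h, abs_zero, Real.zero_rpow hr.ne', Real.zero_rpow hq.ne']
      simp
  have hi : Integrable (fun x => |v x| ^ r) volume := by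
    refine Integrable.mono' ((hind (1 ^ r)).add (hvi.const_mul (1 ^ (r - q))))
      ((continuous_abs.rpow_const fun _ => Or.inr hr.le).comp_aestronglyMeasurable hv.1) ?_
    filter_upwards [hb 1 one_pos] with x hx
    rw [Real.norm_of_nonneg (by positivity)]
    exact hx
  refine ⟨hi, fun τ hτ => ?_⟩
  have h1 := integral_mono_ae hi ((hind (τ ^ r)).add (hvi.const_mul (τ ^ (r - q)))) (hb τ hτ)
  simp only [Pi.add_apply] at h1
  rw [integral_add (hind _) (hvi.const_mul _), integral_indicator hΩm, setIntegral_const,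
    smul_eq_mul, integral_const_mul, mul_comm (volume.real Ω)] at h1
  exact h1

theorem abs_abs_rpow_sub_abs_rpow_le (hr : 0 < r) (hr1 : r ≤ 1) (a b : ℝ) :
    |(|a| ^ r - |b| ^ r)| ≤ |a - b| ^ r := by
  have key : ∀ a b : ℝ, |a| ^ r ≤ |a - b| ^ r + |b| ^ r := fun a b => by
    have h1 : |a| ≤ |a - b| + |b| := by
      have := abs_add_le (a - b) b
      rwa [sub_add_cancel] at this
    exact (Real.rpow_le_rpow (abs_nonneg _) h1 hr.le).trans
      (Real.rpow_add_le_add_rpow (abs_nonneg _) (abs_nonneg _) hr.le hr1)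
  have h1 := key a b
  have h2 := key b a
  rw [abs_sub_comm] at h2
  rw [abs_le]
  constructor <;> linarith

/-- Subadditivity of t^r for r ≤ 1 reduces the claim to ∫|F n − u|^r, which is at most τ^r|Ω| plus a
multiple of the L^p integral; τ is fixed first, then n is taken large. -/
theorem tendsto_integral_abs_rpow (hr : 0 < r) (hr1 : r ≤ 1) (hp : 1 < p) (hΩm : MeasurableSet Ω)
    (hΩ : Bornology.IsBounded Ω) {F : ℕ → EuclideanSpace ℝ (Fin N) → ℝ}
    (hF : ∀ n, MemX0 s p Ω (F n)) (hu : MemX0 s p Ω u)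
    (hlim : Tendsto (fun n => ∫ x, |F n x - u x| ^ p) atTop (𝓝 0)) :
    Tendsto (fun n => ∫ x, |F n x| ^ r) atTop (𝓝 (∫ x, |u x| ^ r)) := by
  have hp0 : 0 < p := by linarith
  have hX : ∀ n, MemX0 s p Ω fun x => F n x - u x := fun n => (hF n).sub hp0 hu
  have hi : ∀ {w}, MemX0 s p Ω w → Integrable (fun x => |w x| ^ r) volume := fun hw =>
    (integral_abs_rpow_le_of_support hr (by linarith) hΩm hΩ hw.1.1 hw.2).1
  rw [Metric.tendsto_atTop]
  intro ε hε
  obtain ⟨τ, hτ0, hτ⟩ : ∃ τ : ℝ, 0 < τ ∧ τ ^ r * volume.real Ω < ε / 2 := by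
    have h1 : Tendsto (fun τ : ℝ => τ ^ r * volume.real Ω) (𝓝[>] 0)
        (𝓝 ((0 : ℝ) ^ r * volume.real Ω)) :=
      ((tendsto_id.mono_left nhdsWithin_le_nhds).rpow_const (Or.inr hr.le)).mul_const _
    rw [Real.zero_rpow hr.ne', zero_mul] at h1
    obtain ⟨τ, h2, h3⟩ := ((h1.eventually_lt_const (by positivity : (0 : ℝ) < ε / 2)).and
      self_mem_nhdsWithin).exists
    exact ⟨τ, h3, h2⟩
  have h2 := hlim.const_mul (τ ^ (r - p))
  rw [mul_zero] at h2
  obtain ⟨n₀, hn₀⟩ := eventually_atTop.1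
    (h2.eventually_lt_const (by positivity : (0 : ℝ) < ε / 2))
  refine ⟨n₀, fun n hn => ?_⟩
  rw [Real.dist_eq, ← integral_sub (hi (hF n)) (hi hu)]
  calc |∫ x, (|F n x| ^ r - |u x| ^ r)| ≤ ∫ x, |(|F n x| ^ r - |u x| ^ r)| :=
        abs_integral_le_integral_abs
    _ ≤ ∫ x, |F n x - u x| ^ r :=
        integral_mono ((hi (hF n)).sub (hi hu)).abs (hi (hX n))
          fun x => abs_abs_rpow_sub_abs_rpow_le hr hr1 _ _
    _ ≤ τ ^ r * volume.real Ω + τ ^ (r - p) * ∫ x, |F n x - u x| ^ p :=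
        (integral_abs_rpow_le_of_support hr (by linarith) hΩm hΩ (hX n).1.1 (hX n).2).2 τ hτ0
    _ < ε := by have := hn₀ n hn; linarith

end Sublinear

/-! ### Minimization of the energy functional on a small ball of X₀. -/

section Minimization

variable {N : ℕ} {s p γ lam : ℝ} {Ω : Set (EuclideanSpace ℝ (Fin N))} {M : ℝ → ℝ}
  {u v : EuclideanSpace ℝ (Fin N) → ℝ}

/-- The energy functional of the Kirchhoff problem. -/
noncomputable def kirchhoffFunctional (s p γ : ℝ) (M : ℝ → ℝ) (lam : ℝ)
    (v : EuclideanSpace ℝ (Fin N) → ℝ) : ℝ :=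
  1 / p * (∫ τ in (0 : ℝ)..gagliardoEnergy s p v, M τ) - lam / (1 - γ) * (∫ x, |v x| ^ (1 - γ))
    - 1 / fracCriticalExponent N s p * ∫ x, |v x| ^ fracCriticalExponent N s p

theorem lt_fracCriticalExponent (hp : 0 < p) (hs : 0 < s) (hps : p * s < N) :
    p < fracCriticalExponent N s p := by
  have : 0 < p * s := by positivity
  rw [fracCriticalExponent, lt_div_iff₀ (by linarith)]
  nlinarith

/-- The primitive is kept at the true energy of v, while the two negative terms are estimated
through R. This gives boundedness below on the ball and, at energy exactly R, the lower bound on its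
boundary. -/
theorem le_kirchhoffFunctional (hp : 1 < p) (hs : 0 < s) (hps : p * s < N) (hγ0 : 0 < γ)
    (hγ1 : γ < 1) (hΩo : IsOpen Ω) (hΩ : Bornology.IsBounded Ω) (hlam : 0 < lam)
    {S : ℝ} (hS0 : 0 < S) (hS : ∀ u : EuclideanSpace ℝ (Fin N) → ℝ, MemX0 s p Ω u →
      MemLp u (ENNReal.ofReal (fracCriticalExponent N s p)) volume ∧
      ∫ x, |u x| ^ fracCriticalExponent N s p
        ≤ S * gagliardoEnergy s p u ^ (fracCriticalExponent N s p / p))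
    {R : ℝ} (hv : MemX0 s p Ω v) (hE : gagliardoEnergy s p v ≤ R) :
    1 / p * (∫ τ in (0 : ℝ)..gagliardoEnergy s p v, M τ)
      - lam / (1 - γ) * (volume.real Ω + S * R ^ (fracCriticalExponent N s p / p))
      - 1 / fracCriticalExponent N s p * (S * R ^ (fracCriticalExponent N s p / p))
      ≤ kirchhoffFunctional s p γ M lam v := by
  have hp0 : 0 < p := by linarith
  have hpq := lt_fracCriticalExponent hp0 hs hps
  obtain ⟨h1, h2⟩ := hS v hv
  set q := fracCriticalExponent N s p
  have hE0 := gagliardoEnergy_nonneg (s := s) (p := p) v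
  have h3 : ∫ x, |v x| ^ q ≤ S * R ^ (q / p) :=
    h2.trans (by have : 0 ≤ q / p := by { have : 0 < q := by linarith
                                          positivity }
                 gcongr)
  have h4 := (integral_abs_rpow_le_of_support (r := 1 - γ) (by linarith) (by linarith)
    hΩo.measurableSet hΩ h1 hv.2).2 1 one_pos
  rw [Real.one_rpow, Real.one_rpow, one_mul, one_mul] at h4
  have h5 : lam / (1 - γ) * ∫ x, |v x| ^ (1 - γ)
      ≤ lam / (1 - γ) * (volume.real Ω + S * R ^ (q / p)) := by
    have : 0 < 1 - γ := by linarith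
    gcongr
    linarith
  have h6 : 1 / q * ∫ x, |v x| ^ q ≤ 1 / q * (S * R ^ (q / p)) := by
    have : 0 < q := by linarith
    gcongr
  rw [kirchhoffFunctional]
  linarith

theorem exists_minimizer (hp : 1 < p) (hs : 0 < s) (hps : p * s < N) (hγ0 : 0 < γ)
    (hγ1 : γ < 1) (hΩo : IsOpen Ω) (hΩ : Bornology.IsBounded Ω) (hlam : 0 < lam)
    (hMc : Continuous M) (hMm : Monotone M) (hM0 : ∀ t, 0 ≤ M t)
    {S : ℝ} (hS0 : 0 < S) (hS : ∀ u : EuclideanSpace ℝ (Fin N) → ℝ, MemX0 s p Ω u →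
      MemLp u (ENNReal.ofReal (fracCriticalExponent N s p)) volume ∧
      ∫ x, |u x| ^ fracCriticalExponent N s p
        ≤ S * gagliardoEnergy s p u ^ (fracCriticalExponent N s p / p))
    {R : ℝ} (hR0 : 0 ≤ R) (hR : ∀ d, 0 ≤ d → d ≤ R →
      1 / fracCriticalExponent N s p * (S * d ^ (fracCriticalExponent N s p / p))
        ≤ 1 / p * ∫ τ in (0 : ℝ)..d, M τ) :
    ∃ u : EuclideanSpace ℝ (Fin N) → ℝ, MemX0 s p Ω u ∧ gagliardoEnergy s p u ≤ R ∧
      ∀ v : EuclideanSpace ℝ (Fin N) → ℝ, MemX0 s p Ω v → gagliardoEnergy s p v ≤ R →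
        kirchhoffFunctional s p γ M lam u ≤ kirchhoffFunctional s p γ M lam v := by
  have hp0 : 0 < p := by linarith
  have hpq := lt_fracCriticalExponent hp0 hs hps
  have hlow := fun v hv hE => le_kirchhoffFunctional (M := M) hp hs hps hγ0 hγ1 hΩo hΩ hlam hS0 hS
    (R := R) (v := v) hv hE
  set q := fracCriticalExponent N s p with hq
  have hq0 : 0 < q := by linarith
  set J := kirchhoffFunctional (N := N) s p γ M lam with hJ
  set T : Set ℝ := J '' {v | MemX0 s p Ω v ∧ gagliardoEnergy s p v ≤ R} with hT
  have hzero : MemX0 s p Ω (fun _ : EuclideanSpace ℝ (Fin N) => (0 : ℝ)) := by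
    refine (memX0_iff hp0).2 ⟨MemLp.zero', ?_, ae_of_all _ fun _ _ => rfl⟩
    have e : gagliardoQuotient s p (fun _ : EuclideanSpace ℝ (Fin N) => (0 : ℝ))
        = fun _ => 0 := by funext z; simp [gagliardoQuotient]
    rw [e]; exact MemLp.zero'
  have hTne : T.Nonempty := by
    refine ⟨_, mem_image_of_mem J (x := fun _ => (0 : ℝ)) ⟨hzero, ?_⟩⟩
    simpa [gagliardoEnergy, gagliardoIntegrand, Real.zero_rpow hp0.ne'] using hR0
  have hTb : BddBelow T := by
    refine ⟨- (lam / (1 - γ) * (volume.real Ω + S * R ^ (q / p))) - 1 / q * (S * R ^ (q / p)), ?_⟩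
    rintro _ ⟨v, hv, rfl⟩
    have h1 := hlow v hv.1 hv.2
    have h2 : 0 ≤ 1 / p * (∫ τ in (0 : ℝ)..gagliardoEnergy s p v, M τ) :=
      mul_nonneg (by positivity)
        (intervalIntegral.integral_nonneg (gagliardoEnergy_nonneg v) fun t _ => hM0 t)
    linarith
  obtain ⟨m, -, hm, hmT⟩ := exists_seq_tendsto_sInf hTne hTb
  choose F₀ hF₀ hF₀m using hmT
  obtain ⟨ns, hns, u, hu, hae, hLp⟩ := exists_subseq_ae_tendsto hp hs hps hΩo hΩ
    (fun n => (hF₀ n).1) (fun n => (hF₀ n).2)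
  obtain ⟨e, he, ks, hks, hE⟩ := (isCompact_Icc (a := (0 : ℝ)) (b := R)).tendsto_subseq
    (x := fun n => gagliardoEnergy s p (F₀ (ns n))) fun n => ⟨gagliardoEnergy_nonneg _, (hF₀ _).2⟩
  set F : ℕ → EuclideanSpace ℝ (Fin N) → ℝ := fun n => F₀ (ns (ks n)) with hF
  have hFX : ∀ n, MemX0 s p Ω (F n) := fun n => (hF₀ _).1
  have hFE : ∀ n, gagliardoEnergy s p (F n) ≤ R := fun n => (hF₀ _).2
  have hEe : Tendsto (fun n => gagliardoEnergy s p (F n)) atTop (𝓝 e) := hE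
  have hFae : ∀ᵐ x ∂volume, Tendsto (fun n => F n x) atTop (𝓝 (u x)) := by
    filter_upwards [hae] with x hx
    exact hx.comp hks.tendsto_atTop
  have hFLp : Tendsto (fun n => ∫ x, |F n x - u x| ^ p) atTop (𝓝 0) :=
    hLp.comp hks.tendsto_atTop
  have hFJ : Tendsto (fun n => J (F n)) atTop (𝓝 (sInf T)) := by
    have : Tendsto (fun n => m (ns (ks n))) atTop (𝓝 (sInf T)) :=
      (hm.comp hns.tendsto_atTop).comp hks.tendsto_atTop
    refine this.congr fun n => ?_
    exact (hF₀m _).symm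
  have hdX : ∀ n, MemX0 s p Ω (fun x => F n x - u x) := fun n => (hFX n).sub hp0 hu
  have hBLE : Tendsto (fun n => gagliardoEnergy s p (F n)
      - gagliardoEnergy s p (fun x => F n x - u x)) atTop (𝓝 (gagliardoEnergy s p u)) := by
    simp only [gagliardoEnergy_eq hp0, gagliardoQuotient_sub]
    refine tendsto_integral_abs_rpow_sub hp0 (fun n => ((memX0_iff hp0).1 (hFX n)).2.1) (C := R)
      (fun n => ?_) (ae_tendsto_gagliardoQuotient hFae)
    rw [← gagliardoEnergy_eq hp0]
    exact hFE n
  have hBLq : Tendsto (fun n => (∫ x, |F n x| ^ q) - ∫ x, |F n x - u x| ^ q) atTop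
      (𝓝 (∫ x, |u x| ^ q)) := by
    refine tendsto_integral_abs_rpow_sub hq0 (fun n => (hS _ (hFX n)).1) (C := S * R ^ (q / p))
      (fun n => (hS _ (hFX n)).2.trans ?_) hFae
    have := hFE n
    have := gagliardoEnergy_nonneg (s := s) (p := p) (F n)
    gcongr
  -- By Brezis–Lieb, d is the limit of the energies of F n − u. It is positive exactly when energy
  -- is lost in the limit.
  set d := e - gagliardoEnergy s p u with hd
  have hdE : Tendsto (fun n => gagliardoEnergy s p (fun x => F n x - u x)) atTop (𝓝 d) := by
    refine (hEe.sub hBLE).congr fun n => ?_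
    ring
  have hd0 : 0 ≤ d := ge_of_tendsto' hdE fun n => gagliardoEnergy_nonneg _
  have hu0 := gagliardoEnergy_nonneg (s := s) (p := p) u
  have hdR : d ≤ R := by linarith [he.2]
  have huR : gagliardoEnergy s p u ≤ R := by linarith [he.2]
  have hsing := tendsto_integral_abs_rpow (r := 1 - γ) (by linarith) (by linarith) hp
    hΩo.measurableSet hΩ hFX hu hFLp
  have hMcont : Continuous fun t => ∫ τ in (0 : ℝ)..t, M τ :=
    continuous_iff_continuousAt.2 fun t => (hasDerivAt_primitive hMc t).continuousAt
  -- The critical term of F n is split into its Brezis–Lieb part, which converges, and the L^q mass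
  -- of F n − u, which is replaced by its Sobolev bound. The resulting lower bound for J (F n) has a
  -- limit.
  have hlowlim : Tendsto (fun n => 1 / p * (∫ τ in (0 : ℝ)..gagliardoEnergy s p (F n), M τ)
      - lam / (1 - γ) * (∫ x, |F n x| ^ (1 - γ))
      - 1 / q * ((∫ x, |F n x| ^ q) - ∫ x, |F n x - u x| ^ q)
      - 1 / q * (S * gagliardoEnergy s p (fun x => F n x - u x) ^ (q / p))) atTop
      (𝓝 (1 / p * (∫ τ in (0 : ℝ)..e, M τ) - lam / (1 - γ) * (∫ x, |u x| ^ (1 - γ))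
        - 1 / q * (∫ x, |u x| ^ q) - 1 / q * (S * d ^ (q / p)))) :=
    ((((hMcont.tendsto e).comp hEe).const_mul _).sub (hsing.const_mul _)).sub
      (hBLq.const_mul _) |>.sub (((hdE.rpow_const (Or.inr (by positivity))).const_mul _).const_mul _)
  have hle : 1 / p * (∫ τ in (0 : ℝ)..e, M τ) - lam / (1 - γ) * (∫ x, |u x| ^ (1 - γ))
        - 1 / q * (∫ x, |u x| ^ q) - 1 / q * (S * d ^ (q / p)) ≤ sInf T := by
    refine le_of_tendsto_of_tendsto' hlowlim hFJ fun n => ?_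
    have h1 := mul_le_mul_of_nonneg_left (hS _ (hdX n)).2 (by positivity : 0 ≤ 1 / q)
    simp only [hJ, kirchhoffFunctional, ← hq]
    rw [mul_sub]
    linarith
  have hsuper := integral_add_integral_le_of_monotone hMc hMm hu0 hd0
  rw [show gagliardoEnergy s p u + d = e by rw [hd]; ring] at hsuper
  have hsuper' := mul_le_mul_of_nonneg_left hsuper (by positivity : 0 ≤ 1 / p)
  rw [mul_add] at hsuper'
  -- Superadditivity leaves 𝓜(d)/p to spare, and `hR` at d says that this absorbs the lost critical
  -- mass.
  have hJu : J u ≤ sInf T := by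
    have := hR d hd0 hdR
    simp only [hJ, kirchhoffFunctional, ← hq]
    linarith
  exact ⟨u, hu, huR, fun v hv hvR => hJu.trans (csInf_le hTb (mem_image_of_mem J ⟨hv, hvR⟩))⟩

theorem kirchhoffFunctional_abs_le (hp : 0 < p) (hMc : Continuous M) (hM0 : ∀ t, 0 ≤ M t)
    (hu : MemX0 s p Ω u) :
    kirchhoffFunctional s p γ M lam (fun x => |u x|) ≤ kirchhoffFunctional s p γ M lam u := by
  simp only [kirchhoffFunctional, abs_abs]
  gcongr
  exact primitive_le_primitive hMc hM0 (gagliardoEnergy_comp_le hp hu lipschitzWith_abs abs_zero)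

/-- Along tψ the first term is O(t^p), as M is bounded on bounded intervals, the singular term is a
negative multiple of t^(1−γ), and the critical term only helps; p > 1−γ decides for small t. -/
theorem exists_kirchhoffFunctional_neg (hp : 1 < p) (hs0 : 0 < s) (hs1 : s < 1) (hps : p * s < N)
    (hγ0 : 0 < γ) (hγ1 : γ < 1) (hΩo : IsOpen Ω) (hΩ : Bornology.IsBounded Ω) (hne : Ω.Nonempty)
    (hlam : 0 < lam) (hMc : Continuous M) (hMm : Monotone M) {R : ℝ} (hR : 0 < R) :
    ∃ v : EuclideanSpace ℝ (Fin N) → ℝ, MemX0 s p Ω v ∧ gagliardoEnergy s p v ≤ R ∧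
      kirchhoffFunctional s p γ M lam v < 0 := by
  have hp0 : 0 < p := by linarith
  have hpq := lt_fracCriticalExponent hp0 hs0 hps
  have hN : 0 < N := by
    have : (0 : ℝ) < N := lt_trans (by positivity) hps
    exact_mod_cast this
  have h1γ : 0 < 1 - γ := by linarith
  obtain ⟨ψ, hψ, hψ0, hψpos⟩ := exists_memX0_pos hN hp0 hs0 hs1 hΩo hΩ
  set q := fracCriticalExponent N s p with hq
  have hq0 : 0 < q := by linarith
  set E := gagliardoEnergy s p ψ with hEdef
  have hE0 : 0 ≤ E := gagliardoEnergy_nonneg ψ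
  set B := ∫ x, |ψ x| ^ (1 - γ) with hB
  have hBpos : 0 < B := by
    rw [hB, integral_pos_iff_support_of_nonneg (fun x => by positivity)
      (integral_abs_rpow_le_of_support h1γ (by linarith) hΩo.measurableSet hΩ hψ.1.1 hψ.2).1]
    refine (hΩo.measure_pos volume hne).trans_le (measure_mono fun x hx => ?_)
    exact (Real.rpow_pos_of_pos (abs_pos.2 (hψpos x hx).ne') _).ne'
  have hlim1 : Tendsto (fun t : ℝ => 1 / p * (M E * E) * t ^ (p - (1 - γ))) (𝓝[>] 0)
      (𝓝 (1 / p * (M E * E) * (0 : ℝ) ^ (p - (1 - γ)))) :=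
    ((tendsto_id.mono_left nhdsWithin_le_nhds).rpow_const (Or.inr (by linarith))).const_mul _
  have hlim2 : Tendsto (fun t : ℝ => t ^ p * E) (𝓝[>] 0) (𝓝 ((0 : ℝ) ^ p * E)) :=
    ((tendsto_id.mono_left nhdsWithin_le_nhds).rpow_const (Or.inr hp0.le)).mul_const _
  rw [Real.zero_rpow (by linarith), mul_zero] at hlim1
  rw [Real.zero_rpow hp0.ne', zero_mul] at hlim2
  have hlim3 : Tendsto (fun t : ℝ => t) (𝓝[>] 0) (𝓝 0) := tendsto_id.mono_left nhdsWithin_le_nhds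
  have hc : 0 < lam / (1 - γ) * B := by positivity
  obtain ⟨t, ht1, ht2, ht3, ht0⟩ := ((hlim1.eventually_lt_const hc).and
    ((hlim2.eventually_lt_const hR).and ((hlim3.eventually_lt_const one_pos).and
      self_mem_nhdsWithin))).exists
  have ht0 : 0 < t := ht0
  have hEt : gagliardoEnergy s p (fun x => t * ψ x) = t ^ p * E := by
    rw [gagliardoEnergy_const_mul, abs_of_pos ht0]
  refine ⟨fun x => t * ψ x, hψ.const_mul hp0 t, by rw [hEt]; exact ht2.le, ?_⟩
  have htE : t ^ p * E ≤ E := by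
    have : t ^ p ≤ 1 := Real.rpow_le_one ht0.le ht3.le hp0.le
    nlinarith
  have hprim : ∫ τ in (0 : ℝ)..(t ^ p * E), M τ ≤ M E * (t ^ p * E) := by
    have h1 : ∫ τ in (0 : ℝ)..(t ^ p * E), M τ ≤ ∫ τ in (0 : ℝ)..(t ^ p * E), M E :=
      intervalIntegral.integral_mono_on (by positivity) (hMc.intervalIntegrable _ _)
        intervalIntegrable_const fun τ hτ => hMm (hτ.2.trans htE)
    rw [intervalIntegral.integral_const, smul_eq_mul, sub_zero] at h1
    linarith
  have hBt : ∫ x, |t * ψ x| ^ (1 - γ) = t ^ (1 - γ) * B := by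
    rw [hB, ← integral_const_mul]
    congr 1; funext x
    rw [abs_mul, abs_of_pos ht0, Real.mul_rpow ht0.le (abs_nonneg _)]
  have hP : 0 ≤ 1 / q * ∫ x, |t * ψ x| ^ q :=
    mul_nonneg (by positivity) (integral_nonneg fun x => by positivity)
  rw [kirchhoffFunctional, hEt, hBt, ← hq]
  have h1 : 1 / p * (∫ τ in (0 : ℝ)..(t ^ p * E), M τ) ≤ 1 / p * (M E * (t ^ p * E)) := by gcongr
  have h2 : t ^ p = t ^ (p - (1 - γ)) * t ^ (1 - γ) := by
    rw [← Real.rpow_add ht0]; congr 1; ring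
  have h3 : 0 < t ^ (1 - γ) := by positivity
  have h4 := mul_lt_mul_of_pos_right ht1 h3
  rw [h2] at h1
  have h5 : 1 / p * (M E * (t ^ (p - (1 - γ)) * t ^ (1 - γ) * E))
      = 1 / p * (M E * E) * t ^ (p - (1 - γ)) * t ^ (1 - γ) := by ring
  rw [h5] at h1
  have h6 : lam / (1 - γ) * (t ^ (1 - γ) * B) = lam / (1 - γ) * B * t ^ (1 - γ) := by ring
  rw [h2, h6]
  linarith

/-- For small parameters the energy functional has a nonnegative interior minimizer on a ball
of `X₀`. -/
theorem exists_nonneg_interior_minimizer (hp : 1 < p) (hs0 : 0 < s) (hs1 : s < 1)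
    (hps : p * s < N) (hγ0 : 0 < γ) (hγ1 : γ < 1) (hΩo : IsOpen Ω) (hΩ : Bornology.IsBounded Ω)
    (hne : Ω.Nonempty) (hMc : Continuous M) (hMm : Monotone M) (hM0 : ∀ t, 0 ≤ M t)
    {a ϑ : ℝ} (ha : 0 < a) (hϑ0 : 0 < ϑ) (hϑ : ϑ < fracCriticalExponent N s p / p)
    (hMa : ∀ t, 0 ≤ t → a * t ^ ϑ ≤ ∫ τ in (0 : ℝ)..t, M τ) :
    ∃ R lam₀ : ℝ, 0 < lam₀ ∧ ∀ lam : ℝ, 0 < lam → lam ≤ lam₀ →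
      ∃ u : EuclideanSpace ℝ (Fin N) → ℝ, MemX0 s p Ω u ∧ (∀ x, 0 ≤ u x) ∧
        gagliardoEnergy s p u < R ∧
        ∀ v : EuclideanSpace ℝ (Fin N) → ℝ, MemX0 s p Ω v → gagliardoEnergy s p v ≤ R →
          kirchhoffFunctional s p γ M lam u ≤ kirchhoffFunctional s p γ M lam v := by
  have hp0 : 0 < p := by linarith
  have hpq := lt_fracCriticalExponent hp0 hs0 hps
  obtain ⟨S, hS0, hS⟩ := exists_fractional_sobolev hp0 hs0 hps hΩ
  have h1γ : 0 < 1 - γ := by linarith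
  set q := fracCriticalExponent N s p with hq
  have hq0 : 0 < q := by linarith
  set κ := q / p - ϑ with hκ
  have hκ0 : 0 < κ := by linarith
  -- Chosen so that, for d ≤ R, the critical term uses at most half of the lower bound (a/p) d^ϑ of
  -- the Kirchhoff term. The other half, at d = R, is what the singular term may consume, and this
  -- determines the threshold for λ.
  set R := (a * q / (2 * p * S)) ^ κ⁻¹ with hRdef
  have hR0 : 0 < R := by positivity
  have hRκ : R ^ κ = a * q / (2 * p * S) := Real.rpow_inv_rpow (by positivity) hκ0.ne'
  have hsmall : ∀ d, 0 ≤ d → d ≤ R → 1 / q * (S * d ^ (q / p)) ≤ a / (2 * p) * d ^ ϑ := by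
    intro d hd0 hdR
    rcases hd0.eq_or_lt with rfl | hd
    · rw [Real.zero_rpow (by positivity), Real.zero_rpow hϑ0.ne']; simp
    have h1 : d ^ (q / p) = d ^ ϑ * d ^ κ := by
      rw [← Real.rpow_add hd, hκ]; congr 1; ring
    have h2 : d ^ κ ≤ R ^ κ := by gcongr
    rw [hRκ] at h2
    calc 1 / q * (S * d ^ (q / p)) = S / q * d ^ ϑ * d ^ κ := by rw [h1]; ring
      _ ≤ S / q * d ^ ϑ * (a * q / (2 * p * S)) := by gcongr
      _ = a / (2 * p) * d ^ ϑ := by field_simp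
  have hR : ∀ d, 0 ≤ d → d ≤ R →
      1 / q * (S * d ^ (q / p)) ≤ 1 / p * ∫ τ in (0 : ℝ)..d, M τ := by
    intro d hd0 hdR
    refine (hsmall d hd0 hdR).trans ?_
    have h1 := mul_le_mul_of_nonneg_left (hMa d hd0) (by positivity : 0 ≤ 1 / p)
    refine le_trans ?_ h1
    have h2 : 0 ≤ d ^ ϑ := by positivity
    have h3 : a / (2 * p) ≤ 1 / p * a := by
      rw [div_mul_eq_mul_div, one_mul]
      gcongr
      linarith
    nlinarith
  have hD : 0 < volume.real Ω + S * R ^ (q / p) := by positivity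
  refine ⟨R, a / (2 * p) * R ^ ϑ * (1 - γ) / (volume.real Ω + S * R ^ (q / p)), by positivity,
    fun lam hlam hle => ?_⟩
  obtain ⟨u, hu, huR, hmin⟩ := exists_minimizer hp hs0 hps hγ0 hγ1 hΩo hΩ hlam hMc hMm hM0 hS0 hS
    hR0.le hR
  have hE := gagliardoEnergy_comp_le hp0 hu lipschitzWith_abs abs_zero
  have hX := hu.comp_lipschitz hp0 lipschitzWith_abs abs_zero
  have hJ := kirchhoffFunctional_abs_le (γ := γ) (lam := lam) hp0 hMc hM0 hu
  refine ⟨fun x => |u x|, hX, fun x => abs_nonneg _, lt_of_le_of_ne (hE.trans huR) fun hEq => ?_,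
    fun v hv hvR => hJ.trans (hmin v hv hvR)⟩
  obtain ⟨v, hv, hvR, hvneg⟩ := exists_kirchhoffFunctional_neg hp hs0 hs1 hps hγ0 hγ1 hΩo hΩ hne
    hlam hMc hMm hR0
  have hneg := (hJ.trans (hmin v hv hvR)).trans_lt hvneg
  have hlow := le_kirchhoffFunctional (M := M) hp hs0 hps hγ0 hγ1 hΩo hΩ hlam hS0 hS (R := R)
    hX hEq.le
  rw [hEq, ← hq] at hlow
  have h1 := hsmall R hR0.le le_rfl
  have h2 := mul_le_mul_of_nonneg_left (hMa R hR0.le) (by positivity : 0 ≤ 1 / p)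
  have h3 : lam / (1 - γ) * (volume.real Ω + S * R ^ (q / p)) ≤ a / (2 * p) * R ^ ϑ := by
    rw [le_div_iff₀ hD] at hle
    rw [div_mul_eq_mul_div, div_le_iff₀ h1γ]
    exact hle
  have h4 : 1 / p * (a * R ^ ϑ) = a / (2 * p) * R ^ ϑ + a / (2 * p) * R ^ ϑ := by
    field_simp; ring
  linarith

end Minimization

/-! ### One-sided first variation of the energy functional. -/

section FirstVariation

variable {N : ℕ} {s p γ lam : ℝ} {Ω : Set (EuclideanSpace ℝ (Fin N))} {M : ℝ → ℝ}
  {u v φ : EuclideanSpace ℝ (Fin N) → ℝ}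

/-- The derivative at `u` in direction `φ` of the differentiable part of the energy functional. -/
noncomputable def regularVariation (s p : ℝ) (M : ℝ → ℝ) (u φ : EuclideanSpace ℝ (Fin N) → ℝ) : ℝ :=
  M (gagliardoEnergy s p u) * fracPLaplacianForm s p u φ -
    ∫ x, |u x| ^ (fracCriticalExponent N s p - 2) * u x * φ x

theorem fracPLaplacianForm_eq (hp : 0 < p) (u φ : EuclideanSpace ℝ (Fin N) → ℝ) :
    fracPLaplacianForm s p u φ = ∫ z, |gagliardoQuotient s p u z| ^ (p - 2) *
      gagliardoQuotient s p u z * gagliardoQuotient s p φ z :=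
  integral_congr_ae (ae_of_all _ (fracPLaplacianIntegrand_eq hp u φ))

theorem integrable_fracPLaplacianIntegrand (hp : 1 < p) (hu : MemX0 s p Ω u)
    (hφ : MemX0 s p Ω φ) : Integrable (fracPLaplacianIntegrand s p u φ) volume := by
  have hp0 : 0 < p := by linarith
  rw [show fracPLaplacianIntegrand s p u φ = _ from funext (fracPLaplacianIntegrand_eq hp0 u φ)]
  exact integrable_abs_rpow_sub_two_mul hp ((memX0_iff hp0).1 hu).2.1 ((memX0_iff hp0).1 hφ).2.1

theorem hasDerivAt_gagliardoEnergy (hp : 1 < p) (hu : MemX0 s p Ω u) (hφ : MemX0 s p Ω φ) :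
    HasDerivAt (fun t : ℝ => gagliardoEnergy s p fun x => u x + t * φ x)
      (p * fracPLaplacianForm s p u φ) 0 := by
  have hp0 : 0 < p := by linarith
  have h := hasDerivAt_integral_abs_add_mul_rpow hp ((memX0_iff hp0).1 hu).2.1
    ((memX0_iff hp0).1 hφ).2.1
  rw [← fracPLaplacianForm_eq hp0] at h
  have e : (fun t : ℝ => gagliardoEnergy s p fun x => u x + t * φ x) = fun t : ℝ =>
      ∫ z, |gagliardoQuotient s p u z + t * gagliardoQuotient s p φ z| ^ p := by
    funext t
    rw [gagliardoEnergy_eq hp0, gagliardoQuotient_add, gagliardoQuotient_const_mul]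
  rw [e]
  exact h

theorem hasDerivAt_regular_part (hp : 1 < p) (hq : 1 < fracCriticalExponent N s p)
    (hMc : Continuous M)
    (hL : ∀ v : EuclideanSpace ℝ (Fin N) → ℝ, MemX0 s p Ω v →
      MemLp v (ENNReal.ofReal (fracCriticalExponent N s p)) volume)
    (hu : MemX0 s p Ω u) (hφ : MemX0 s p Ω φ) :
    HasDerivAt (fun t : ℝ =>
      1 / p * (∫ τ in (0 : ℝ)..gagliardoEnergy s p fun x => u x + t * φ x, M τ)
      - 1 / fracCriticalExponent N s p * ∫ x, |u x + t * φ x| ^ fracCriticalExponent N s p)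
      (regularVariation s p M u φ) 0 := by
  have hp0 : 0 < p := by linarith
  have h1 := hasDerivAt_gagliardoEnergy hp hu hφ
  have h2 := hasDerivAt_integral_abs_add_mul_rpow hq (hL u hu) (hL φ hφ)
  have h3 := (hasDerivAt_primitive hMc (gagliardoEnergy s p fun x => u x + 0 * φ x)).comp 0 h1
  have h4 := (h3.const_mul (1 / p)).sub (h2.const_mul (1 / fracCriticalExponent N s p))
  refine h4.congr_deriv ?_
  simp only [zero_mul, add_zero, regularVariation]
  have : fracCriticalExponent N s p ≠ 0 := by linarith
  field_simp

/-- The tangent line to the concave function t^r at b lies above its graph. The tangency point is b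
because a may be 0; in the application a = u(x) and b = u(x) + tφ(x). -/
theorem rpow_sub_rpow_ge {r a b : ℝ} (hr0 : 0 ≤ r) (hr1 : r ≤ 1) (ha : 0 ≤ a) (hb : 0 < b) :
    r * (b - a) * (b ^ (1 - r))⁻¹ ≤ b ^ r - a ^ r := by
  have h1 : -1 ≤ (a - b) / b := by rw [le_div_iff₀ hb]; linarith
  have h2 := rpow_one_add_le_one_add_mul_self h1 hr0 hr1
  have e : 1 + (a - b) / b = a / b := by field_simp; ring
  rw [e, Real.div_rpow ha hb.le] at h2
  have hbr : 0 < b ^ r := by positivity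
  rw [div_le_iff₀ hbr] at h2
  have e2 : (b ^ (1 - r))⁻¹ = b ^ r / b := by
    rw [← Real.rpow_neg hb.le, neg_sub, Real.rpow_sub_one hb.ne']
  rw [e2]
  have e3 : (1 + r * ((a - b) / b)) * b ^ r = b ^ r - r * (b - a) * (b ^ r / b) := by
    field_simp; ring
  linarith

/-- `u` minimizes the energy functional over a ball of `X₀` that contains it in its interior. -/
def IsInteriorMinimizer (s p γ : ℝ) (Ω : Set (EuclideanSpace ℝ (Fin N))) (M : ℝ → ℝ) (lam R : ℝ)
    (u : EuclideanSpace ℝ (Fin N) → ℝ) : Prop :=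
  MemX0 s p Ω u ∧ (∀ x, 0 ≤ u x) ∧ gagliardoEnergy s p u < R ∧
    ∀ v : EuclideanSpace ℝ (Fin N) → ℝ, MemX0 s p Ω v → gagliardoEnergy s p v ≤ R →
      kirchhoffFunctional s p γ M lam u ≤ kirchhoffFunctional s p γ M lam v

variable {R : ℝ}

/-- The energy is continuous along the line u + tφ and strictly below R at t = 0, so perturbations
of either sign stay admissible. -/
theorem IsInteriorMinimizer.eventually_le (hp : 1 < p)
    (hu : IsInteriorMinimizer s p γ Ω M lam R u) (hφ : MemX0 s p Ω φ) :
    ∀ᶠ t in 𝓝 (0 : ℝ), kirchhoffFunctional s p γ M lam u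
      ≤ kirchhoffFunctional s p γ M lam fun x => u x + t * φ x := by
  have hp0 : 0 < p := by linarith
  have hc := (hasDerivAt_gagliardoEnergy hp hu.1 hφ).continuousAt
  have h0 : (gagliardoEnergy s p fun x => u x + 0 * φ x) < R := by simpa using hu.2.2.1
  filter_upwards [hc.eventually_lt_const h0] with t ht
  exact hu.2.2.2 _ (hu.1.add hp0 (hφ.const_mul hp0 t)) ht.le

/-- For t > 0 minimality bounds the increment of the singular term by that of the regular part;
concavity bounds the former below by tφ(u+tφ)^(−γ), and Fatou's lemma lets t → 0. The integral is
taken in `ENNReal` so that u^(−γ) is infinite where u = 0, whereas real division would give 0 there.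
The sign in the first conclusion allows the estimate to be read back in ℝ. -/
theorem IsInteriorMinimizer.variation_nonneg (hp : 1 < p)
    (hq : p < fracCriticalExponent N s p) (hγ0 : 0 < γ) (hγ1 : γ < 1) (hΩo : IsOpen Ω)
    (hΩ : Bornology.IsBounded Ω) (hlam : 0 < lam) (hMc : Continuous M)
    (hL : ∀ v : EuclideanSpace ℝ (Fin N) → ℝ, MemX0 s p Ω v →
      MemLp v (ENNReal.ofReal (fracCriticalExponent N s p)) volume)
    (hu : IsInteriorMinimizer s p γ Ω M lam R u) (hφ : MemX0 s p Ω φ) (hφ0 : ∀ x, 0 ≤ φ x) :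
    0 ≤ regularVariation s p M u φ ∧
    ENNReal.ofReal lam * ∫⁻ x, ENNReal.ofReal (φ x) * (ENNReal.ofReal (u x) ^ γ)⁻¹
      ≤ ENNReal.ofReal (regularVariation s p M u φ) := by
  have hp0 : 0 < p := by linarith
  have h1γ : 0 < 1 - γ := by linarith
  have hder := hasDerivAt_regular_part hp (by linarith) hMc hL hu.1 hφ
  set h : ℝ → ℝ := fun t =>
    1 / p * (∫ τ in (0 : ℝ)..gagliardoEnergy s p fun x => u x + t * φ x, M τ)
      - 1 / fracCriticalExponent N s p * ∫ x, |u x + t * φ x| ^ fracCriticalExponent N s p with hh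
  have hslope : Tendsto (fun t : ℝ => (h t - h 0) / t) (𝓝[>] 0)
      (𝓝 (regularVariation s p M u φ)) := by
    have h1 := hder.tendsto_slope.mono_left (nhdsWithin_mono 0
      (show Ioi (0 : ℝ) ⊆ {0}ᶜ from fun t ht => ne_of_gt ht))
    refine h1.congr fun t => ?_
    rw [slope_def_field, sub_zero]
  have hX : ∀ t : ℝ, MemX0 s p Ω fun x => u x + t * φ x := fun t =>
    hu.1.add hp0 (hφ.const_mul hp0 t)
  have hi : ∀ t : ℝ, Integrable (fun x => |u x + t * φ x| ^ (1 - γ)) volume := fun t =>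
    (integral_abs_rpow_le_of_support h1γ (by linarith) hΩo.measurableSet hΩ (hX t).1.1
      (hX t).2).1
  have hiu : Integrable (fun x => |u x| ^ (1 - γ)) volume := by simpa using hi 0
  have hbound : ∀ t : ℝ, 0 < t → kirchhoffFunctional s p γ M lam u
      ≤ kirchhoffFunctional s p γ M lam (fun x => u x + t * φ x) →
      ENNReal.ofReal lam *
        ∫⁻ x, ENNReal.ofReal (φ x) * (ENNReal.ofReal (u x + t * φ x) ^ γ)⁻¹
        ≤ ENNReal.ofReal ((h t - h 0) / t) ∧ 0 ≤ (h t - h 0) / t := by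
    intro t ht hJ
    have hmono : ∀ x, |u x| ^ (1 - γ) ≤ |u x + t * φ x| ^ (1 - γ) := fun x => by
      have h1 := hu.2.1 x
      have h2 : 0 ≤ t * φ x := mul_nonneg ht.le (hφ0 x)
      rw [abs_of_nonneg h1, abs_of_nonneg (by linarith)]
      gcongr
      linarith
    have hd : lam / (1 - γ) * ∫ x, (|u x + t * φ x| ^ (1 - γ) - |u x| ^ (1 - γ)) ≤ h t - h 0 := by
      rw [integral_sub (hi t) hiu, mul_sub]
      simp only [kirchhoffFunctional] at hJ
      simp only [hh, zero_mul, add_zero]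
      linarith
    have hd0 : 0 ≤ ∫ x, (|u x + t * φ x| ^ (1 - γ) - |u x| ^ (1 - γ)) :=
      integral_nonneg fun x => sub_nonneg.2 (hmono x)
    refine ⟨?_, div_nonneg ((mul_nonneg (by positivity) hd0).trans hd) ht.le⟩
    calc ENNReal.ofReal lam *
          ∫⁻ x, ENNReal.ofReal (φ x) * (ENNReal.ofReal (u x + t * φ x) ^ γ)⁻¹
        = ∫⁻ x, ENNReal.ofReal lam *
            (ENNReal.ofReal (φ x) * (ENNReal.ofReal (u x + t * φ x) ^ γ)⁻¹) :=
          (lintegral_const_mul' _ _ ENNReal.ofReal_ne_top).symm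
      _ ≤ ∫⁻ x, ENNReal.ofReal (lam / (1 - γ) / t) *
            ENNReal.ofReal (|u x + t * φ x| ^ (1 - γ) - |u x| ^ (1 - γ)) := by
          refine lintegral_mono fun x => ?_
          rcases (hφ0 x).eq_or_lt with h0 | h0
          · simp [← h0]
          have hux := hu.2.1 x
          have hpos : 0 < u x + t * φ x := by positivity
          simp only
          rw [ENNReal.ofReal_rpow_of_pos hpos, ← ENNReal.ofReal_inv_of_pos (by positivity),
            ← ENNReal.ofReal_mul h0.le, ← ENNReal.ofReal_mul hlam.le,
            ← ENNReal.ofReal_mul (by positivity)]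
          refine ENNReal.ofReal_le_ofReal ?_
          have h2 := rpow_sub_rpow_ge h1γ.le (by linarith) hux hpos
          rw [add_sub_cancel_left, sub_sub_cancel] at h2
          rw [abs_of_pos hpos, abs_of_nonneg hux]
          have h3 := mul_le_mul_of_nonneg_left h2
            (by positivity : 0 ≤ lam / (1 - γ) / t)
          refine le_trans (le_of_eq ?_) h3
          field_simp
      _ = ENNReal.ofReal (lam / (1 - γ) / t *
            ∫ x, (|u x + t * φ x| ^ (1 - γ) - |u x| ^ (1 - γ))) := by
          have e := ofReal_integral_eq_lintegral_ofReal ((hi t).sub hiu)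
            (ae_of_all _ fun x => sub_nonneg.2 (hmono x))
          simp only [Pi.sub_apply] at e
          rw [lintegral_const_mul' _ _ ENNReal.ofReal_ne_top, ENNReal.ofReal_mul (by positivity), e]
      _ ≤ ENNReal.ofReal ((h t - h 0) / t) := by
          refine ENNReal.ofReal_le_ofReal ?_
          rw [div_mul_eq_mul_div]
          gcongr
  have hev : ∀ᶠ t in 𝓝[>] (0 : ℝ), ENNReal.ofReal lam *
        ∫⁻ x, ENNReal.ofReal (φ x) * (ENNReal.ofReal (u x + t * φ x) ^ γ)⁻¹
        ≤ ENNReal.ofReal ((h t - h 0) / t) ∧ 0 ≤ (h t - h 0) / t := by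
    filter_upwards [nhdsWithin_le_nhds (hu.eventually_le hp hφ), self_mem_nhdsWithin] with t h1 h2
    exact hbound t h2 h1
  refine ⟨ge_of_tendsto hslope (hev.mono fun t ht => ht.2), ?_⟩
  have hseq : Tendsto (fun n : ℕ => 1 / ((n : ℝ) + 1)) atTop (𝓝[>] 0) :=
    tendsto_nhdsWithin_iff.2 ⟨tendsto_one_div_add_atTop_nhds_zero_nat,
      Eventually.of_forall fun n => by
        have : (0 : ℝ) < 1 / ((n : ℝ) + 1) := by positivity
        exact this⟩
  set G : ℕ → EuclideanSpace ℝ (Fin N) → ENNReal := fun n x =>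
    ENNReal.ofReal (φ x) * (ENNReal.ofReal (u x + 1 / ((n : ℝ) + 1) * φ x) ^ γ)⁻¹ with hG
  have hGm : ∀ n, AEMeasurable (G n) volume := fun n =>
    hφ.aestronglyMeasurable.aemeasurable.ennreal_ofReal.mul
      ((((hX _).aestronglyMeasurable.aemeasurable.ennreal_ofReal).pow_const γ).inv)
  have hGlim : ∀ x, Tendsto (fun n => G n x) atTop
      (𝓝 (ENNReal.ofReal (φ x) * (ENNReal.ofReal (u x) ^ γ)⁻¹)) := fun x => by
    refine ENNReal.Tendsto.const_mul ?_ (Or.inr ENNReal.ofReal_ne_top)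
    refine tendsto_inv_iff.2 ?_
    refine ((ENNReal.continuous_rpow_const (y := γ)).tendsto _).comp (ENNReal.tendsto_ofReal ?_)
    simpa using (tendsto_one_div_add_atTop_nhds_zero_nat.mul_const (φ x)).const_add (u x)
  calc ENNReal.ofReal lam * ∫⁻ x, ENNReal.ofReal (φ x) * (ENNReal.ofReal (u x) ^ γ)⁻¹
      = ENNReal.ofReal lam * ∫⁻ x, liminf (fun n => G n x) atTop := by
        congr 1
        exact lintegral_congr fun x => (hGlim x).liminf_eq.symm
    _ ≤ ENNReal.ofReal lam * liminf (fun n => ∫⁻ x, G n x) atTop := by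
        gcongr
        exact lintegral_liminf_le' hGm
    _ = liminf (fun n => ENNReal.ofReal lam * ∫⁻ x, G n x) atTop :=
        (ENNReal.liminf_const_mul_of_ne_top ENNReal.ofReal_ne_top).symm
    _ ≤ liminf (fun n : ℕ => ENNReal.ofReal ((h (1 / ((n : ℝ) + 1)) - h 0) / (1 / ((n : ℝ) + 1))))
          atTop := liminf_le_liminf ((hseq.eventually hev).mono fun n hn => hn.1)
    _ = ENNReal.ofReal (regularVariation s p M u φ) :=
        ((ENNReal.continuous_ofReal.tendsto _).comp (hslope.comp hseq)).liminf_eq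

end FirstVariation

/-! ### From the one-sided inequality to the weak formulation. -/

section WeakSolution

variable {N : ℕ} {s p γ lam R : ℝ} {Ω : Set (EuclideanSpace ℝ (Fin N))} {M : ℝ → ℝ}
  {u v φ : EuclideanSpace ℝ (Fin N) → ℝ}

/-- The first variation of the energy functional at `u` in direction `φ`. -/
noncomputable def fullVariation (s p γ : ℝ) (M : ℝ → ℝ) (lam : ℝ)
    (u φ : EuclideanSpace ℝ (Fin N) → ℝ) : ℝ :=
  regularVariation s p M u φ - lam * ∫ x, φ x / u x ^ γ

/-- The integrand is infinite at every point of Ω where u vanishes, so such points form a null set.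
No maximum principle is needed. -/
theorem ae_pos_of_lintegral_ne_top (hγ0 : 0 < γ) (hu0 : ∀ x, 0 ≤ u x)
    (hum : AEStronglyMeasurable u volume) (hφm : AEStronglyMeasurable φ volume)
    (hφ : ∀ x ∈ Ω, 0 < φ x)
    (h : ∫⁻ x, ENNReal.ofReal (φ x) * (ENNReal.ofReal (u x) ^ γ)⁻¹ ≠ ⊤) :
    ∀ᵐ x ∂volume, x ∈ Ω → 0 < u x := by
  have hm : AEMeasurable (fun x => ENNReal.ofReal (φ x) * (ENNReal.ofReal (u x) ^ γ)⁻¹) volume :=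
    hφm.aemeasurable.ennreal_ofReal.mul ((hum.aemeasurable.ennreal_ofReal.pow_const γ).inv)
  filter_upwards [ae_lt_top' hm h] with x hx hxΩ
  refine (hu0 x).lt_of_ne fun h0 => hx.ne ?_
  rw [← h0, ENNReal.ofReal_zero, ENNReal.zero_rpow_of_pos hγ0, ENNReal.inv_zero]
  exact ENNReal.mul_top (by simpa using hφ x hxΩ)

theorem integrable_div_rpow_of_lintegral_ne_top (hu0 : ∀ x, 0 ≤ u x)
    (hum : AEStronglyMeasurable u volume) (hφm : AEStronglyMeasurable φ volume)
    (hφ0 : ∀ x, 0 ≤ φ x)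
    (h : ∫⁻ x, ENNReal.ofReal (φ x) * (ENNReal.ofReal (u x) ^ γ)⁻¹ ≠ ⊤) :
    Integrable (fun x => φ x / u x ^ γ) volume ∧ ENNReal.ofReal (∫ x, φ x / u x ^ γ)
      ≤ ∫⁻ x, ENNReal.ofReal (φ x) * (ENNReal.ofReal (u x) ^ γ)⁻¹ := by
  have hm : AEStronglyMeasurable (fun x => φ x / u x ^ γ) volume :=
    (hφm.aemeasurable.div (hum.aemeasurable.pow_const γ)).aestronglyMeasurable
  have h0 : ∀ x, 0 ≤ φ x / u x ^ γ := fun x =>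
    div_nonneg (hφ0 x) (Real.rpow_nonneg (hu0 x) _)
  have hle : ∫⁻ x, ENNReal.ofReal (φ x / u x ^ γ)
      ≤ ∫⁻ x, ENNReal.ofReal (φ x) * (ENNReal.ofReal (u x) ^ γ)⁻¹ := by
    refine lintegral_mono fun x => ?_
    rcases (hu0 x).eq_or_lt with hx | hx
    · rcases eq_or_ne γ 0 with rfl | hγ
      · simp
      · simp [← hx, Real.zero_rpow hγ]
    · simp only
      rw [ENNReal.ofReal_rpow_of_pos hx, ENNReal.ofReal_div_of_pos (by positivity),
        ENNReal.div_eq_inv_mul, mul_comm]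
  have hi : Integrable (fun x => φ x / u x ^ γ) volume := by
    refine ⟨hm, ?_⟩
    rw [hasFiniteIntegral_iff_ofReal (ae_of_all _ h0)]
    exact hle.trans_lt h.lt_top
  refine ⟨hi, ?_⟩
  rwa [ofReal_integral_eq_lintegral_ofReal hi (ae_of_all _ h0)]

theorem fullVariation_add (hp : 1 < p) (hq : 1 < fracCriticalExponent N s p)
    (hL : ∀ v : EuclideanSpace ℝ (Fin N) → ℝ, MemX0 s p Ω v →
      MemLp v (ENNReal.ofReal (fracCriticalExponent N s p)) volume)
    (hsing : ∀ φ : EuclideanSpace ℝ (Fin N) → ℝ, MemX0 s p Ω φ →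
      Integrable (fun x => φ x / u x ^ γ) volume)
    (hu : MemX0 s p Ω u) (hv : MemX0 s p Ω v) (hφ : MemX0 s p Ω φ) :
    fullVariation s p γ M lam u (fun x => v x + φ x)
      = fullVariation s p γ M lam u v + fullVariation s p γ M lam u φ := by
  have hp0 : 0 < p := by linarith
  have h1 : fracPLaplacianForm s p u (fun x => v x + φ x)
      = fracPLaplacianForm s p u v + fracPLaplacianForm s p u φ := by
    rw [fracPLaplacianForm, fracPLaplacianForm, fracPLaplacianForm,
      ← integral_add (integrable_fracPLaplacianIntegrand hp hu hv)
        (integrable_fracPLaplacianIntegrand hp hu hφ)]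
    congr 1; funext z
    simp only [fracPLaplacianIntegrand]; ring
  have h2 : ∫ x, |u x| ^ (fracCriticalExponent N s p - 2) * u x * (v x + φ x)
      = (∫ x, |u x| ^ (fracCriticalExponent N s p - 2) * u x * v x)
        + ∫ x, |u x| ^ (fracCriticalExponent N s p - 2) * u x * φ x := by
    rw [← integral_add (integrable_abs_rpow_sub_two_mul hq (hL u hu) (hL v hv))
        (integrable_abs_rpow_sub_two_mul hq (hL u hu) (hL φ hφ))]
    congr 1; funext x; ring
  have h3 : ∫ x, (v x + φ x) / u x ^ γ = (∫ x, v x / u x ^ γ) + ∫ x, φ x / u x ^ γ := by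
    rw [← integral_add (hsing v hv) (hsing φ hφ)]
    congr 1; funext x; ring
  simp only [fullVariation, regularVariation, h1, h2, h3]
  ring

theorem fullVariation_const_mul (c : ℝ) (u φ : EuclideanSpace ℝ (Fin N) → ℝ) :
    fullVariation s p γ M lam u (fun x => c * φ x) = c * fullVariation s p γ M lam u φ := by
  have h1 : fracPLaplacianForm s p u (fun x => c * φ x) = c * fracPLaplacianForm s p u φ := by
    rw [fracPLaplacianForm, fracPLaplacianForm, ← integral_const_mul]
    congr 1; funext z
    simp only [fracPLaplacianIntegrand]; ring
  have h2 : ∫ x, |u x| ^ (fracCriticalExponent N s p - 2) * u x * (c * φ x)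
      = c * ∫ x, |u x| ^ (fracCriticalExponent N s p - 2) * u x * φ x := by
    rw [← integral_const_mul]
    congr 1; funext x; ring
  have h3 : ∫ x, c * φ x / u x ^ γ = c * ∫ x, φ x / u x ^ γ := by
    rw [← integral_const_mul]
    congr 1; funext x; ring
  simp only [fullVariation, regularVariation, h1, h2, h3]
  ring

/-- In the direction u the singular term is homogeneous, a constant times (1+t)^(1−γ), hence
differentiable at t = 0 from both sides, and Fermat's rule applies. -/
theorem IsInteriorMinimizer.fullVariation_self (hp : 1 < p)
    (hq : 1 < fracCriticalExponent N s p) (hγ1 : γ < 1)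
    (hMc : Continuous M)
    (hL : ∀ v : EuclideanSpace ℝ (Fin N) → ℝ, MemX0 s p Ω v →
      MemLp v (ENNReal.ofReal (fracCriticalExponent N s p)) volume)
    (hu : IsInteriorMinimizer s p γ Ω M lam R u) : fullVariation s p γ M lam u u = 0 := by
  have h1γ : 0 < 1 - γ := by linarith
  have h1 := hasDerivAt_regular_part hp hq hMc hL hu.1 hu.1
  have h2 : HasDerivAt (fun t : ℝ => (1 + t) ^ (1 - γ)) (1 - γ) 0 := by
    have := ((hasDerivAt_id (0 : ℝ)).const_add 1).rpow_const (p := 1 - γ) (Or.inl (by simp))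
    simpa using this
  have h3 := h1.sub ((h2.mul_const (∫ x, |u x| ^ (1 - γ))).const_mul (lam / (1 - γ)))
  have e : ∀ᶠ t in 𝓝 (0 : ℝ), kirchhoffFunctional s p γ M lam (fun x => u x + t * u x)
      = (1 / p * (∫ τ in (0 : ℝ)..gagliardoEnergy s p fun x => u x + t * u x, M τ)
        - 1 / fracCriticalExponent N s p * ∫ x, |u x + t * u x| ^ fracCriticalExponent N s p)
        - lam / (1 - γ) * ((1 + t) ^ (1 - γ) * ∫ x, |u x| ^ (1 - γ)) := by
    filter_upwards [eventually_gt_nhds (show (-1 : ℝ) < 0 by norm_num)] with t ht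
    have e1 : ∫ x, |u x + t * u x| ^ (1 - γ) = (1 + t) ^ (1 - γ) * ∫ x, |u x| ^ (1 - γ) := by
      rw [← integral_const_mul]
      congr 1; funext x
      rw [← one_add_mul, abs_mul, abs_of_pos (by linarith : 0 < 1 + t),
        Real.mul_rpow (by linarith) (abs_nonneg _)]
    rw [kirchhoffFunctional, e1]; ring
  have h4 := h3.congr_of_eventuallyEq e
  have hmin : IsLocalMin (fun t : ℝ => kirchhoffFunctional s p γ M lam fun x => u x + t * u x) 0 := by
    filter_upwards [hu.eventually_le hp hu.1] with t ht
    simpa using ht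
  have h5 := hmin.hasDerivAt_eq_zero h4
  have e2 : ∫ x, u x / u x ^ γ = ∫ x, |u x| ^ (1 - γ) := by
    congr 1; funext x
    rw [abs_of_nonneg (hu.2.1 x)]
    rcases (hu.2.1 x).eq_or_lt with hx | hx
    · rw [← hx, Real.zero_rpow h1γ.ne', zero_div]
    · rw [Real.rpow_sub hx, Real.rpow_one]
  rw [fullVariation, e2, ← h5]
  field_simp

/-- If a ≥ b, then −ka is at most −kb, so the k-terms only lower the difference of the positive
parts. The bound is uniform in k, which provides the dominating function below. -/
theorem mul_max_sub_max_le {a b c d k : ℝ} (hk : 0 ≤ k) :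
    (a - b) * (max (c - k * a) 0 - max (d - k * b) 0) ≤ |a - b| * |c - d| := by
  have key : ∀ {a b c d : ℝ}, b ≤ a →
      max (c - k * a) 0 - max (d - k * b) 0 ≤ |c - d| := fun {a b c d} hab => by
    have h1 : max (c - k * a) 0 ≤ max (c - k * b) 0 := by
      have : k * b ≤ k * a := by gcongr
      exact max_le_max (by linarith) le_rfl
    have h2 := (le_abs_self _).trans (abs_max_sub_max_le_abs (c - k * b) (d - k * b) 0)
    rw [sub_sub_sub_cancel_right] at h2
    linarith
  rcases le_total b a with h | h
  · rw [abs_of_nonneg (sub_nonneg.2 h)]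
    exact mul_le_mul_of_nonneg_left (key h) (sub_nonneg.2 h)
  · rw [abs_of_nonpos (sub_nonpos.2 h), abs_sub_comm c d]
    have := mul_le_mul_of_nonneg_left (key (c := d) (d := c) h) (sub_nonneg.2 h)
    linarith

theorem fracPLaplacianIntegrand_max_le (hp : 1 < p) {k : ℝ} (hk : 0 ≤ k)
    (z : EuclideanSpace ℝ (Fin N) × EuclideanSpace ℝ (Fin N)) :
    fracPLaplacianIntegrand s p u (fun x => max (φ x - k * u x) 0) z
      ≤ |gagliardoQuotient s p u z| ^ (p - 1) * |gagliardoQuotient s p φ z| := by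
  rw [fracPLaplacianIntegrand_eq (by linarith), ← abs_rpow_sub_two_mul_self _ hp, abs_mul,
    abs_of_nonneg (by positivity : 0 ≤ |gagliardoQuotient s p u z| ^ (p - 2)), mul_assoc, mul_assoc]
  refine mul_le_mul_of_nonneg_left ?_ (by positivity)
  have hκ : 0 ≤ ‖z.1 - z.2‖ ^ (((N : ℝ) + p * s) / p) := by positivity
  simp only [gagliardoQuotient]
  rw [div_mul_div_comm, ← abs_mul, div_mul_div_comm, abs_div, abs_mul,
    abs_of_nonneg (mul_nonneg hκ hκ)]
  exact div_le_div_of_nonneg_right (mul_max_sub_max_le hk) (mul_nonneg hκ hκ)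

/-- For a.e. x, (φ−ku)⁺(x) is eventually 0: in Ω because u > 0, outside because φ = 0 ≤ u. Only the
positive part of the integrand is dominated uniformly in k, and only an upper bound is needed. -/
theorem tendsto_integral_max_fracPLaplacianIntegrand (hp : 1 < p) (hu : MemX0 s p Ω u)
    (hu0 : ∀ x, 0 ≤ u x) (hpos : ∀ᵐ x ∂volume, x ∈ Ω → 0 < u x) (hφ : MemX0 s p Ω φ) :
    Tendsto (fun k : ℕ => ∫ z, max
      (fracPLaplacianIntegrand s p u (fun x => max (φ x - (k : ℝ) * u x) 0) z) 0) atTop (𝓝 0) := by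
  have hp0 : 0 < p := by linarith
  have hX : ∀ k : ℝ, MemX0 s p Ω fun x => max (φ x - k * u x) 0 := fun k =>
    (hφ.sub hp0 (hu.const_mul hp0 k)).comp_lipschitz hp0 lipschitzWith_max_zero (by simp)
  have h := tendsto_integral_of_dominated_convergence
    (F := fun (k : ℕ) z => max
      (fracPLaplacianIntegrand s p u (fun x => max (φ x - (k : ℝ) * u x) 0) z) 0)
    (f := fun _ => (0 : ℝ)) (μ := volume) _
    (fun k => (integrable_fracPLaplacianIntegrand hp hu (hX k)).1.sup aestronglyMeasurable_const)
    (integrable_abs_rpow_mul hp ((memX0_iff hp0).1 hu).2.1 ((memX0_iff hp0).1 hφ).2.1)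
    (fun k => ae_of_all _ fun z => by
      rw [Real.norm_of_nonneg (le_max_right _ _)]
      exact max_le (fracPLaplacianIntegrand_max_le hp k.cast_nonneg z) (by positivity))
    (by
      have hev : ∀ᵐ x ∂volume, ∀ᶠ k : ℕ in atTop, max (φ x - (k : ℝ) * u x) 0 = 0 := by
        filter_upwards [hpos, hφ.2] with x h1 h2
        by_cases hx : x ∈ Ω
        · filter_upwards [eventually_ge_atTop ⌈φ x / u x⌉₊] with k hk
          have := (div_le_iff₀ (h1 hx)).1 (Nat.ceil_le.1 hk)
          exact max_eq_right (by linarith)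
        · refine Eventually.of_forall fun k => max_eq_right ?_
          rw [h2 hx]
          have := mul_nonneg (k.cast_nonneg (α := ℝ)) (hu0 x)
          linarith
      filter_upwards [ae_prod_of_ae hev] with z hz
      refine tendsto_const_nhds.congr' ?_
      filter_upwards [hz.1, hz.2] with k h1 h2
      simp [fracPLaplacianIntegrand, h1, h2])
  rwa [integral_zero] at h

theorem fullVariation_eq_zero (hp : 1 < p) (hq : 1 < fracCriticalExponent N s p)
    (hlam : 0 < lam) (hM0 : ∀ t, 0 ≤ M t)
    (hL : ∀ v : EuclideanSpace ℝ (Fin N) → ℝ, MemX0 s p Ω v →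
      MemLp v (ENNReal.ofReal (fracCriticalExponent N s p)) volume)
    (hsing : ∀ φ : EuclideanSpace ℝ (Fin N) → ℝ, MemX0 s p Ω φ →
      Integrable (fun x => φ x / u x ^ γ) volume)
    (hu : MemX0 s p Ω u) (hu0 : ∀ x, 0 ≤ u x) (hpos : ∀ᵐ x ∂volume, x ∈ Ω → 0 < u x)
    (hnonneg : ∀ φ : EuclideanSpace ℝ (Fin N) → ℝ, MemX0 s p Ω φ → (∀ x, 0 ≤ φ x) →
      0 ≤ fullVariation s p γ M lam u φ)
    (hself : fullVariation s p γ M lam u u = 0) (hφ : MemX0 s p Ω φ) :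
    fullVariation s p γ M lam u φ = 0 := by
  have hp0 : 0 < p := by linarith
  have key : ∀ φ : EuclideanSpace ℝ (Fin N) → ℝ, MemX0 s p Ω φ →
      fullVariation s p γ M lam u φ ≤ 0 := by
    intro φ hφ
    have hlim := (tendsto_integral_max_fracPLaplacianIntegrand hp hu hu0 hpos hφ).const_mul
      (M (gagliardoEnergy s p u))
    rw [mul_zero] at hlim
    refine ge_of_tendsto' hlim fun k => ?_
    have hw : MemX0 s p Ω fun x => φ x - (k : ℝ) * u x := hφ.sub hp0 (hu.const_mul hp0 _)
    have hw1 : MemX0 s p Ω fun x => max (φ x - (k : ℝ) * u x) 0 :=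
      hw.comp_lipschitz hp0 lipschitzWith_max_zero (by simp)
    have hw2 : MemX0 s p Ω fun x => max (-1 * (φ x - (k : ℝ) * u x)) 0 :=
      (hw.const_mul hp0 (-1)).comp_lipschitz hp0 lipschitzWith_max_zero (by simp)
    have hsplit : φ = fun x => max (φ x - (k : ℝ) * u x) 0
        + (-1 * max (-1 * (φ x - (k : ℝ) * u x)) 0 + (k : ℝ) * u x) := by
      funext x
      rcases le_total (φ x - (k : ℝ) * u x) 0 with h | h
      · rw [max_eq_right h, max_eq_left (by linarith)]; ring
      · rw [max_eq_left h, max_eq_right (by linarith)]; ring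
    -- The summand ku contributes k times the variation at u, which is zero.
    have hA : fullVariation s p γ M lam u φ
        = fullVariation s p γ M lam u (fun x => max (φ x - (k : ℝ) * u x) 0)
          - fullVariation s p γ M lam u (fun x => max (-1 * (φ x - (k : ℝ) * u x)) 0) := by
      conv_lhs => rw [hsplit]
      rw [fullVariation_add hp hq hL hsing hu hw1
          ((hw2.const_mul hp0 (-1)).add hp0 (hu.const_mul hp0 _)),
        fullVariation_add hp hq hL hsing hu (hw2.const_mul hp0 (-1)) (hu.const_mul hp0 _),
        fullVariation_const_mul, fullVariation_const_mul, hself]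
      ring
    have h1 := hnonneg _ hw2 fun x => le_max_right _ _
    have h2 : 0 ≤ lam * ∫ x, max (φ x - (k : ℝ) * u x) 0 / u x ^ γ :=
      mul_nonneg hlam.le (integral_nonneg fun x =>
        div_nonneg (le_max_right _ _) (Real.rpow_nonneg (hu0 x) _))
    have h3 : 0 ≤ ∫ x, |u x| ^ (fracCriticalExponent N s p - 2) * u x
        * max (φ x - (k : ℝ) * u x) 0 :=
      integral_nonneg fun x => mul_nonneg (mul_nonneg (by positivity) (hu0 x)) (le_max_right _ _)
    have h4 : fracPLaplacianForm s p u (fun x => max (φ x - (k : ℝ) * u x) 0)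
        ≤ ∫ z, max (fracPLaplacianIntegrand s p u (fun x => max (φ x - (k : ℝ) * u x) 0) z) 0 :=
      integral_mono (integrable_fracPLaplacianIntegrand hp hu hw1)
        ((integrable_fracPLaplacianIntegrand hp hu hw1).sup (integrable_zero _ _ _))
        fun z => le_max_left _ _
    have h5 := mul_le_mul_of_nonneg_left h4 (hM0 (gagliardoEnergy s p u))
    rw [hA]
    -- The singular and critical terms enter the variation with a minus sign and are nonnegative on
    -- (φ−ku)⁺, so they can be dropped.
    have h6 : fullVariation s p γ M lam u (fun x => max (φ x - (k : ℝ) * u x) 0)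
        ≤ M (gagliardoEnergy s p u)
          * fracPLaplacianForm s p u (fun x => max (φ x - (k : ℝ) * u x) 0) := by
      rw [fullVariation, regularVariation]
      linarith
    linarith
  refine le_antisymm (key φ hφ) ?_
  have := key _ (hφ.const_mul hp0 (-1))
  rw [fullVariation_const_mul] at this
  linarith

/-- An interior minimizer of the energy functional is a weak solution. -/
theorem IsInteriorMinimizer.isKirchhoffSolution (hp : 1 < p) (hs0 : 0 < s) (hs1 : s < 1)
    (hps : p * s < N) (hγ0 : 0 < γ) (hγ1 : γ < 1) (hΩo : IsOpen Ω)
    (hΩ : Bornology.IsBounded Ω) (hlam : 0 < lam) (hMc : Continuous M) (hM0 : ∀ t, 0 ≤ M t)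
    (hu : IsInteriorMinimizer s p γ Ω M lam R u) : IsKirchhoffSolution s p γ Ω M lam u := by
  have hp0 : 0 < p := by linarith
  have hN : 0 < N := by
    have : (0 : ℝ) < N := lt_trans (by positivity) hps
    exact_mod_cast this
  have hpq := lt_fracCriticalExponent hp0 hs0 hps
  have hq1 : 1 < fracCriticalExponent N s p := by linarith
  obtain ⟨S, -, hS⟩ := exists_fractional_sobolev (Ω := Ω) hp0 hs0 hps hΩ
  have hL := fun v hv => (hS v hv).1
  have hvar := fun φ (hφ : MemX0 s p Ω φ) hφ0 =>
    hu.variation_nonneg hp hpq hγ0 hγ1 hΩo hΩ hlam hMc hL hφ hφ0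
  have hum := hu.1.aestronglyMeasurable
  have hlint : ∀ φ : EuclideanSpace ℝ (Fin N) → ℝ, MemX0 s p Ω φ → (∀ x, 0 ≤ φ x) →
      ∫⁻ x, ENNReal.ofReal (φ x) * (ENNReal.ofReal (u x) ^ γ)⁻¹ ≠ ⊤ := by
    intro φ hφ hφ0 htop
    have h := (hvar φ hφ hφ0).2
    rw [htop, ENNReal.mul_top (by simpa using hlam)] at h
    exact ENNReal.ofReal_ne_top (top_le_iff.1 h)
  obtain ⟨ψ, hψ, hψ0, hψpos⟩ := exists_memX0_pos hN hp0 hs0 hs1 hΩo hΩ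
  have hpos := ae_pos_of_lintegral_ne_top hγ0 hu.2.1 hum hψ.aestronglyMeasurable hψpos
    (hlint ψ hψ hψ0)
  have hsing : ∀ φ : EuclideanSpace ℝ (Fin N) → ℝ, MemX0 s p Ω φ →
      Integrable (fun x => φ x / u x ^ γ) volume := by
    intro φ hφ
    have habs := hφ.comp_lipschitz hp0 lipschitzWith_abs abs_zero
    refine (integrable_div_rpow_of_lintegral_ne_top hu.2.1 hum habs.aestronglyMeasurable
      (fun x => abs_nonneg _) (hlint _ habs fun x => abs_nonneg _)).1.mono'
      (hφ.aestronglyMeasurable.aemeasurable.div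
        (hum.aemeasurable.pow_const γ)).aestronglyMeasurable (ae_of_all _ fun x => ?_)
    rw [Real.norm_eq_abs, abs_div, abs_of_nonneg (Real.rpow_nonneg (hu.2.1 x) γ)]
  have hnonneg : ∀ φ : EuclideanSpace ℝ (Fin N) → ℝ, MemX0 s p Ω φ → (∀ x, 0 ≤ φ x) →
      0 ≤ fullVariation s p γ M lam u φ := by
    intro φ hφ hφ0
    obtain ⟨h1, h2⟩ := hvar φ hφ hφ0
    have h3 := (integrable_div_rpow_of_lintegral_ne_top hu.2.1 hum hφ.aestronglyMeasurable hφ0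
      (hlint φ hφ hφ0)).2
    have h4 := (mul_le_mul_right h3 (ENNReal.ofReal lam)).trans h2
    rw [← ENNReal.ofReal_mul hlam.le, ENNReal.ofReal_le_ofReal_iff h1] at h4
    rw [fullVariation]
    linarith
  have hself := hu.fullVariation_self hp hq1 hγ1 hMc hL
  refine ⟨hu.1, hpos, fun φ hφ => ?_⟩
  have hzero := fullVariation_eq_zero hp hq1 hlam hM0 hL hsing hu.1 hu.2.1 hpos hnonneg hself hφ
  have e : ∀ x, |u x| ^ (fracCriticalExponent N s p - 2) * u x * φ x
      = u x ^ (fracCriticalExponent N s p - 1) * φ x := fun x => by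
    congr 1
    have h := abs_rpow_sub_two_mul_self (u x) hq1
    rw [abs_of_nonneg (mul_nonneg (by positivity) (hu.2.1 x))] at h
    rw [h, abs_of_nonneg (hu.2.1 x)]
  have hpow := integrable_abs_rpow_sub_two_mul hq1 (hL u hu.1) (hL φ hφ)
  simp only [e] at hpow
  refine ⟨integrable_fracPLaplacianIntegrand hp hu.1 hφ, (hsing φ hφ).integrableOn,
    hpow.integrableOn, ?_⟩
  rw [setIntegral_eq_integral_of_ae_compl_eq_zero
      (hφ.2.mono fun x hx hxΩ => by rw [hx hxΩ, zero_div]),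
    setIntegral_eq_integral_of_ae_compl_eq_zero
      (hφ.2.mono fun x hx hxΩ => by rw [hx hxΩ, mul_zero])]
  simp only [fullVariation, regularVariation, e] at hzero
  linarith

theorem isKirchhoffSolution_zero (hp : 0 < p) :
    IsKirchhoffSolution (N := N) s p γ ∅ M lam fun _ => 0 := by
  have hz : ∀ φ : EuclideanSpace ℝ (Fin N) → ℝ,
      fracPLaplacianIntegrand s p (fun _ => 0) φ = fun _ => 0 := fun φ => by
    funext z; simp [fracPLaplacianIntegrand]
  refine ⟨(memX0_iff hp).2 ⟨MemLp.zero', ?_, ae_of_all _ fun _ _ => rfl⟩,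
    ae_of_all _ fun x hx => hx.elim, fun φ _ => ⟨?_, ?_, ?_, ?_⟩⟩
  · rw [show gagliardoQuotient s p (fun _ : EuclideanSpace ℝ (Fin N) => (0 : ℝ))
      = fun _ => 0 by funext z; simp [gagliardoQuotient]]
    exact MemLp.zero'
  · rw [hz]; exact integrable_zero _ _ _
  · exact integrableOn_empty
  · exact integrableOn_empty
  · simp [fracPLaplacianForm, hz]

end WeakSolution

/-! ### The existence theorem. -/

theorem theorem3p3 (N : ℕ) (s p γ : ℝ) (hs0 : 0 < s) (hs1 : s < 1) (hp : 1 < p)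
    (hN : p * s < (N : ℝ)) (hγ0 : 0 < γ) (hγ1 : γ < 1)
    (Ω : Set (EuclideanSpace ℝ (Fin N))) (hΩo : IsOpen Ω) (hΩb : Bornology.IsBounded Ω)
    (M : ℝ → ℝ) (hM : KirchhoffCondition N s p M) :
    ∃ lam₀ : ℝ, 0 < lam₀ ∧ ∀ lam : ℝ, 0 < lam → lam ≤ lam₀ →
      ∃ u : EuclideanSpace ℝ (Fin N) → ℝ, IsKirchhoffSolution s p γ Ω M lam u := by
  have hp0 : 0 < p := by linarith
  -- For empty Ω there is no competitor of negative energy, but the zero function solves the problem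
  -- trivially.
  rcases Ω.eq_empty_or_nonempty with rfl | hne
  · exact ⟨1, one_pos, fun lam _ _ => ⟨_, isKirchhoffSolution_zero hp0⟩⟩
  obtain ⟨hM0, hMc, hMm, a, ϑ, ha, hϑ0, hϑ1, hMa⟩ := hM
  have hpq := lt_fracCriticalExponent hp0 hs0 hN
  obtain ⟨h1ϑ, hϑq⟩ : 0 < ϑ ∧ ϑ < fracCriticalExponent N s p / p := by
    rcases (hM0 0 le_rfl).eq_or_lt with h | h
    · obtain ⟨h1, h2⟩ := hϑ0 h.symm
      exact ⟨by linarith, h2⟩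
    · rw [hϑ1 h]
      exact ⟨one_pos, by rwa [lt_div_iff₀ hp0, one_mul]⟩
  -- The coefficient is extended constantly to the left of 0, so that it is continuous and monotone
  -- on all of ℝ; only its values at nonnegative energies enter the equation.
  set M' : ℝ → ℝ := fun t => M (max t 0) with hM'
  have hM'eq : ∀ t, 0 ≤ t → M' t = M t := fun t ht => by rw [hM']; simp [max_eq_left ht]
  have hM'c : Continuous M' :=
    hMc.comp_continuous (continuous_id.max continuous_const) fun t => mem_Ici.2 (le_max_right _ _)
  have hM'm : Monotone M' := fun x y hxy =>
    hMm (mem_Ici.2 (le_max_right _ _)) (mem_Ici.2 (le_max_right _ _)) (max_le_max hxy le_rfl)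
  have hM'a : ∀ t, 0 ≤ t → a * t ^ ϑ ≤ ∫ τ in (0 : ℝ)..t, M' τ := fun t ht => by
    rw [intervalIntegral.integral_congr (g := M) fun τ hτ => hM'eq τ ?_]
    · exact hMa t ht
    · rw [uIcc_of_le ht] at hτ; exact hτ.1
  obtain ⟨R, lam₀, hlam₀, h⟩ := exists_nonneg_interior_minimizer hp hs0 hs1 hN hγ0 hγ1 hΩo hΩb hne
    hM'c hM'm (fun t => hM0 _ (le_max_right _ _)) ha h1ϑ hϑq hM'a
  refine ⟨lam₀, hlam₀, fun lam hlam hle => ?_⟩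
  obtain ⟨u, hu⟩ := h lam hlam hle
  have hu' : IsInteriorMinimizer s p γ Ω M' lam R u := hu
  obtain ⟨h1, h2, h3⟩ := hu'.isKirchhoffSolution hp hs0 hs1 hN hγ0 hγ1 hΩo hΩb hlam hM'c
    fun t => hM0 _ (le_max_right _ _)
  rw [hM'eq _ (gagliardoEnergy_nonneg u)] at h3
  exact ⟨u, h1, h2, h3⟩
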